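/- Let $\ell\in\mathbb{Z}$ satisfy $\ell\not\equiv 0 \bmod 2$, $\ell\not\equiv 0\bmod 3$, $\ell\equiv 1 \bmod 5$, $\ell\equiv 2\bmod 7$, and suppose that every prime divisor $p$ of $\ell$ satisfies $p\equiv\pm1 \bmod 8$. Put $k=18\ell^2$, so that $k\neq 0$. Let $\mathcal{U}_k$ be the affine scheme over $\mathbb{Z}$ defined by $$x^2+y^2+z^2-4(x^2y^2+y^2z^2+z^2x^2)+16x^2y^2z^2=k,$$ and let $U_k$ be its generic fibre over $\mathbb{Q}$. Write $\mathcal{U}_k(\mathbf{A}_{\mathbb{Z}})=U_k(\mathbb{R})\times\prod_p\mathcal{U}_k(\mathbb{Z}_p)$. Let $\mathrm{Br}_0\,U_k$ be the image of $\mathrm{Br}\,\mathbb{Q}\to\mathrm{Br}\,U_k$ and let $\mathrm{Br}_1\,U_k$ be the kernel of $\mathrm{Br}\,U_k\to\mathrm{Br}(U_k\times_{\mathbb{Q}}\overline{\mathbb{Q}})$. The functions $4x^2-1$ and $4y^2-1$ are invertible on $U_k$; let $\mathcal{A}_1=(4x^2-1,k)$ and $\mathcal{A}_2=(4y^2-1,k)$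 be the classes in $\mathrm{Br}\,U_k$ of the corresponding quaternion algebras, and let $A$ be the subgroup of $\mathrm{Br}\,U_k/\mathrm{Br}_0\,U_k$ generated by their images. For a subgroup $B$ of $\mathrm{Br}\,U_k/\mathrm{Br}_0\,U_k$ let $\mathcal{U}_k(\mathbf{A}_{\mathbb{Z}})^{B}$ be the set of points $(P_v)_v\in\mathcal{U}_k(\mathbf{A}_{\mathbb{Z}})$ with $\sum_{v}\mathrm{inv}_v\,\beta(P_v)=0$ in $\mathbb{Q}/\mathbb{Z}$ for all $\beta\in\mathrm{Br}\,U_k$ whose class lies in $B$. Then $A\subset\mathrm{Br}_1\,U_k/\mathrm{Br}_0\,U_k$, and $A$ gives an algebraic Brauer--Manin obstruction to the integral Hasse principle on $\mathcal{U}_k$: one has $\mathcal{U}_k(\mathbf{A}_{\mathbb{Z}})\neq\emptyset$ but $$\mathcal{U}_k(\mathbb{Z})\subset\mathcal{U}_k(\mathbf{A}_{\mathbb{Z}})^{A}=\emptyset,$$ so in particular $\mathcal{U}_k(\mathbb{Z})=\emptyset$. More precisely, for $i=1,2$ one has $\mathrm{inv}_\infty\,\mathcal{A}_i(P)=0$ for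 all $P\in U_k(\mathbb{R})$ and $\mathrm{inv}_p\,\mathcal{A}_i(P)=0$ for all primes $p\neq 2$ and all $P\in\mathcal{U}_k(\mathbb{Z}_p)$, while for every $P\in\mathcal{U}_k(\mathbb{Z}_2)$ at least one of $\mathrm{inv}_2\,\mathcal{A}_1(P)$, $\mathrm{inv}_2\,\mathcal{A}_2(P)$ equals $\tfrac12$. -/

import Mathlib

namespace BrauerAz
open scoped TensorProduct
universe u v

section modules

variable (R : Type u) [CommRing R]

theorem faithfullyFlat_of_faithful (M : Type v) [AddCommGroup M] [Module R M]
    [Module.Finite R M] [Module.Projective R M] [FaithfulSMul R M] :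
    Module.FaithfullyFlat R M where
  submodule_ne_top := by
    intro m hm h
    obtain ⟨r, hr, hr0⟩ := Submodule.exists_sub_one_mem_and_smul_eq_zero_of_fg_of_le_smul m
      (⊤ : Submodule R M) Module.Finite.fg_top (by rw [h])
    have h0 : r = 0 := by
      apply FaithfulSMul.eq_of_smul_eq_smul (α := M)
      intro x
      rw [hr0 x trivial, zero_smul]
    apply hm.ne_top
    rw [Ideal.eq_top_iff_one]
    simpa [h0] using hr

theorem faithfullyFlat_tensor (M : Type u) (N : Type u) [AddCommGroup M] [Module R M]
    [AddCommGroup N] [Module R N] [Module.FaithfullyFlat R M] [Module.FaithfullyFlat R N] :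
    Module.FaithfullyFlat R (M ⊗[R] N) := by
  rw [Module.FaithfullyFlat.iff_flat_and_rTensor_reflects_triviality]
  refine ⟨inferInstance, fun L _ _ h => ?_⟩
  have h1 : Subsingleton ((L ⊗[R] M) ⊗[R] N) :=
    (TensorProduct.assoc R L M N).toEquiv.subsingleton
  have h2 := (Module.FaithfullyFlat.subsingleton_tensorProduct_iff_left R _).1 h1
  exact (Module.FaithfullyFlat.subsingleton_tensorProduct_iff_left R _).1 h2

theorem faithfulSMul_of_faithfullyFlat (A : Type v) [Ring A] [Algebra R A]
    [Module.FaithfullyFlat R A] : FaithfulSMul R A := by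
  rw [faithfulSMul_iff_algebraMap_injective, injective_iff_map_eq_zero]
  intro r hr
  rw [← Module.FaithfullyFlat.one_tmul_eq_zero_iff R R (A := A) r]
  have : (1 : A) ⊗ₜ[R] r = algebraMap R A r ⊗ₜ[R] (1 : R) := by
    rw [Algebra.algebraMap_eq_smul_one, TensorProduct.smul_tmul, smul_eq_mul, mul_one]
  rw [this, hr, TensorProduct.zero_tmul]

/-- `End P ⊗ End Q ≃ End (P ⊗ Q)` for finitely generated projective `P`, `Q`. -/
noncomputable def endTensorEnd (P Q : Type u) [AddCommGroup P] [Module R P] [AddCommGroup Q]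
    [Module R Q] [Module.Finite R P] [Module.Projective R P] [Module.Finite R Q]
    [Module.Projective R Q] :
    Module.End R P ⊗[R] Module.End R Q ≃ₐ[R] Module.End R (P ⊗[R] Q) :=
  AlgEquiv.ofBijective (Module.endTensorEndAlgHom (R := R) (S := R) (A := R) (M := P) (N := Q)) <| by
    have h : ∀ x, Module.endTensorEndAlgHom (R := R) (S := R) (A := R) (M := P) (N := Q) x
        = homTensorHomEquiv R P Q P Q x := by
      intro x
      induction x with
      | zero => simp
      | add x y hx hy => rw [map_add, map_add, hx, hy]
      | tmul f g => 
        rw [Module.endTensorEndAlgHom_apply, homTensorHomEquiv_apply, TensorProduct.homTensorHomMap_apply]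
        rfl
    rw [show (⇑(Module.endTensorEndAlgHom (R := R) (S := R) (A := R) (M := P) (N := Q)))
      = ⇑(homTensorHomEquiv R P Q P Q) from funext h]
    exact (homTensorHomEquiv R P Q P Q).bijective

theorem endTensorEnd_tmul (P Q : Type u) [AddCommGroup P] [Module R P] [AddCommGroup Q]
    [Module R Q] [Module.Finite R P] [Module.Projective R P] [Module.Finite R Q]
    [Module.Projective R Q] (f : Module.End R P) (g : Module.End R Q) (x : P) (y : Q) :
    endTensorEnd R P Q (f ⊗ₜ g) (x ⊗ₜ y) = f x ⊗ₜ g y := rfl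

/-- `S ⊗ End P ≃ End (S ⊗ P)` for finitely generated projective `P`. -/
noncomputable def baseChangeEnd (S : Type u) [CommRing S] [Algebra R S] (P : Type u)
    [AddCommGroup P] [Module R P] [Module.Finite R P] [Module.Projective R P] :
    S ⊗[R] Module.End R P ≃ₐ[S] Module.End S (S ⊗[R] P) :=
  AlgEquiv.ofBijective (LinearMap.tensorProductEnd R S P) <| by
    have h : ∀ x, LinearMap.tensorProductEnd R S P x
        = LinearMap.liftBaseChangeEquiv S (lTensorHomEquivHomLTensor R P S P x) := by
      intro x
      induction x with
      | zero => simp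
      | add x y hx hy => rw [map_add, map_add, map_add, hx, hy]
      | tmul s g =>
        ext p
        simp [LinearMap.tensorProductEnd, TensorProduct.liftAux_tmul, TensorProduct.smul_tmul']
    rw [show (⇑(LinearMap.tensorProductEnd R S P))
      = ⇑(LinearMap.liftBaseChangeEquiv S) ∘ ⇑(lTensorHomEquivHomLTensor R P S P) from funext h]
    exact (LinearEquiv.bijective _).comp (LinearEquiv.bijective _)

theorem baseChangeEnd_tmul (S : Type u) [CommRing S] [Algebra R S] (P : Type u)
    [AddCommGroup P] [Module R P] [Module.Finite R P] [Module.Projective R P]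
    (s t : S) (f : Module.End R P) (x : P) :
    baseChangeEnd R S P (s ⊗ₜ f) (t ⊗ₜ x) = (s * t) ⊗ₜ f x := by
  simp [baseChangeEnd, LinearMap.tensorProductEnd, TensorProduct.liftAux_tmul,
    TensorProduct.smul_tmul']

end modules

section azumaya
variable {R : Type u} [CommRing R]

theorem isAzumaya_of_bij (A : Type u) [Ring A] [Algebra R A] [Module.Finite R A]
    [Module.Projective R A] [Module.FaithfullyFlat R A]
    (h : Function.Bijective (AlgHom.mulLeftRight R A)) : IsAzumaya R A :=
  { faithfulSMul_of_faithfullyFlat R A with bij := h }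

theorem isAzumaya_tensor (A B : Type u) [Ring A] [Algebra R A] [Ring B] [Algebra R B]
    [IsAzumaya R A] [IsAzumaya R B] : IsAzumaya R (A ⊗[R] B) := by
  have := faithfullyFlat_of_faithful R A
  have := faithfullyFlat_of_faithful R B
  have := faithfullyFlat_tensor R A B
  refine isAzumaya_of_bij _ ?_
  let e : (A ⊗[R] B) ⊗[R] (A ⊗[R] B)ᵐᵒᵖ ≃ₐ[R] Module.End R (A ⊗[R] B) :=
    (Algebra.TensorProduct.congr AlgEquiv.refl (Algebra.TensorProduct.opAlgEquiv R R A B).symm).trans <|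
    (Algebra.TensorProduct.tensorTensorTensorComm R R R R A B Aᵐᵒᵖ Bᵐᵒᵖ).trans <|
    (Algebra.TensorProduct.congr (AlgEquiv.ofBijective _ (IsAzumaya.bij (R := R) (A := A)))
      (AlgEquiv.ofBijective _ (IsAzumaya.bij (R := R) (A := B)))).trans <|
    endTensorEnd R A B
  have h : ∀ t, AlgHom.mulLeftRight R (A ⊗[R] B) t = e t := by
    intro t
    induction t with
    | zero => simp
    | add x y hx hy => rw [map_add, map_add, hx, hy]
    | tmul p q =>
      induction q using MulOpposite.rec' with | _ q
      induction p with
      | zero => simp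
      | add x y hx hy => rw [TensorProduct.add_tmul, map_add, map_add, hx, hy]
      | tmul a b =>
        induction q with
        | zero => simp
        | add x y hx hy => rw [MulOpposite.op_add, TensorProduct.tmul_add, map_add, map_add, hx, hy]
        | tmul c d =>
          apply TensorProduct.ext'
          intro x y
          have : e ((a ⊗ₜ b) ⊗ₜ MulOpposite.op (c ⊗ₜ d)) (x ⊗ₜ y) = (a * x * c) ⊗ₜ (b * y * d) := by
            change endTensorEnd R A B (AlgHom.mulLeftRight R A (a ⊗ₜ MulOpposite.op c) ⊗ₜ
              AlgHom.mulLeftRight R B (b ⊗ₜ MulOpposite.op d)) (x ⊗ₜ y) = _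
            rw [endTensorEnd_tmul]
            simp
          rw [this]
          simp
  rw [show ⇑(AlgHom.mulLeftRight R (A ⊗[R] B)) = ⇑e from funext h]
  exact e.bijective

theorem isAzumaya_op (A : Type u) [Ring A] [Algebra R A] [IsAzumaya R A] :
    IsAzumaya R Aᵐᵒᵖ := by
  have := faithfullyFlat_of_faithful R A
  have : Module.FaithfullyFlat R Aᵐᵒᵖ := .of_linearEquiv R A (MulOpposite.opLinearEquiv R).symm
  have : Module.Finite R Aᵐᵒᵖ := .equiv (MulOpposite.opLinearEquiv R (M := A))
  have : Module.Projective R Aᵐᵒᵖ := .of_equiv (MulOpposite.opLinearEquiv R (M := A))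
  refine isAzumaya_of_bij _ ?_
  let e : Aᵐᵒᵖ ⊗[R] Aᵐᵒᵖᵐᵒᵖ ≃ₐ[R] Module.End R Aᵐᵒᵖ :=
    (Algebra.TensorProduct.comm R _ _).trans <|
    (Algebra.TensorProduct.congr (AlgEquiv.opOp R A).symm AlgEquiv.refl).trans <|
    (AlgEquiv.ofBijective _ (IsAzumaya.bij (R := R) (A := A))).trans <|
    (MulOpposite.opLinearEquiv R (M := A)).conjAlgEquiv R
  have h : AlgHom.mulLeftRight R Aᵐᵒᵖ = e.toAlgHom := by
    ext a x <;> simp [e, LinearEquiv.conjAlgEquiv_apply]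
  rw [h]
  exact e.bijective

/-- `(S ⊗ A) ⊗_S (S ⊗ B) ≃ S ⊗ (A ⊗ B)`. -/
noncomputable def baseChangeTensor (S : Type u) [CommRing S] [Algebra R S] (A B : Type u) [Ring A]
    [Algebra R A] [Ring B] [Algebra R B] :
    (S ⊗[R] A) ⊗[S] (S ⊗[R] B) ≃ₐ[S] S ⊗[R] (A ⊗[R] B) :=
  (Algebra.TensorProduct.tensorTensorTensorComm R R S S S A S B).trans
    (Algebra.TensorProduct.congr (Algebra.TensorProduct.lid S S) AlgEquiv.refl)

theorem baseChangeTensor_tmul (S : Type u) [CommRing S] [Algebra R S] (A B : Type u) [Ring A]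
    [Algebra R A] [Ring B] [Algebra R B] (s t : S) (a : A) (b : B) :
    baseChangeTensor S A B ((s ⊗ₜ[R] a) ⊗ₜ[S] (t ⊗ₜ[R] b)) = (s * t) ⊗ₜ[R] (a ⊗ₜ[R] b) := rfl

theorem isAzumaya_baseChange (S : Type u) [CommRing S] [Algebra R S] (A : Type u) [Ring A]
    [Algebra R A] [IsAzumaya R A] : IsAzumaya S (S ⊗[R] A) := by
  have := faithfullyFlat_of_faithful R A
  refine isAzumaya_of_bij _ ?_
  let e : (S ⊗[R] A) ⊗[S] (S ⊗[R] A)ᵐᵒᵖ ≃ₐ[S] Module.End S (S ⊗[R] A) :=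
    (Algebra.TensorProduct.congr AlgEquiv.refl
      ((Algebra.TensorProduct.opAlgEquiv R S S A).symm.trans
        (Algebra.TensorProduct.congr (AlgEquiv.toOpposite S S).symm AlgEquiv.refl))).trans <|
    (baseChangeTensor S A Aᵐᵒᵖ).trans <|
    (Algebra.TensorProduct.congr (AlgEquiv.refl (R := S) (A₁ := S))
      (AlgEquiv.ofBijective (AlgHom.mulLeftRight R A) IsAzumaya.bij)).trans <|
    baseChangeEnd R S A
  have h : ∀ t, AlgHom.mulLeftRight S (S ⊗[R] A) t = e t := by
    intro t
    induction t with
    | zero => simp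
    | add x y hx hy => rw [map_add, map_add, hx, hy]
    | tmul p q =>
      induction q using MulOpposite.rec' with | _ q
      induction p with
      | zero => simp
      | add x y hx hy => rw [TensorProduct.add_tmul, map_add, map_add, hx, hy]
      | tmul s a =>
        induction q with
        | zero => simp
        | add x y hx hy => rw [MulOpposite.op_add, TensorProduct.tmul_add, map_add, map_add, hx, hy]
        | tmul t b =>
          apply TensorProduct.AlgebraTensorModule.ext
          intro r x
          have : e ((s ⊗ₜ a) ⊗ₜ MulOpposite.op (t ⊗ₜ b)) (r ⊗ₜ x) = (s * t * r) ⊗ₜ (a * x * b) := by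
            change baseChangeEnd R S A ((s * t) ⊗ₜ AlgHom.mulLeftRight R A (a ⊗ₜ MulOpposite.op b))
              (r ⊗ₜ x) = _
            rw [baseChangeEnd_tmul]
            simp
          rw [this]
          simp [mul_right_comm]
  rw [show ⇑(AlgHom.mulLeftRight S (S ⊗[R] A)) = ⇑e from funext h]
  exact e.bijective

end azumaya

/-- A bundled Azumaya algebra over a commutative ring. -/
structure AzumayaAlgebra (R : Type u) [CommRing R] where
  carrier : Type u
  [ring : Ring carrier]
  [algebra : Algebra R carrier]
  [isAzumaya : IsAzumaya R carrier]

attribute [instance] AzumayaAlgebra.ring AzumayaAlgebra.algebra AzumayaAlgebra.isAzumaya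

/-- A finitely generated, faithful projective module over a commutative ring (for a finitely
generated projective module, faithful is the same as faithfully flat). -/
structure FaithfulProjective (R : Type u) [CommRing R] where
  carrier : Type u
  [addCommGroup : AddCommGroup carrier]
  [module : Module R carrier]
  [finite : Module.Finite R carrier]
  [projective : Module.Projective R carrier]
  [faithfullyFlat : Module.FaithfullyFlat R carrier]

attribute [instance] FaithfulProjective.addCommGroup FaithfulProjective.module
  FaithfulProjective.finite FaithfulProjective.projective FaithfulProjective.faithfullyFlat

section brauer
variable {R : Type u} [CommRing R]

namespace FaithfulProjective

/-- The module `R`. -/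
def self (R : Type u) [CommRing R] : FaithfulProjective R := ⟨R⟩

/-- The tensor product. -/
noncomputable def tensor (P Q : FaithfulProjective R) : FaithfulProjective R :=
  haveI := faithfullyFlat_tensor R P.carrier Q.carrier
  ⟨P.carrier ⊗[R] Q.carrier⟩

/-- Extension of scalars. -/
noncomputable def baseChange (S : Type u) [CommRing S] [Algebra R S] (P : FaithfulProjective R) :
    FaithfulProjective S := ⟨S ⊗[R] P.carrier⟩

/-- The endomorphism algebra. -/
abbrev E (P : FaithfulProjective R) : Type u := Module.End R P.carrier

end FaithfulProjective

namespace AzumayaAlgebra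

/-- The trivial Azumaya algebra `R`. -/
def self (R : Type u) [CommRing R] : AzumayaAlgebra R := ⟨R⟩

/-- The tensor product. -/
noncomputable def tensor (A B : AzumayaAlgebra R) : AzumayaAlgebra R :=
  haveI := isAzumaya_tensor (R := R) A.carrier B.carrier
  ⟨A.carrier ⊗[R] B.carrier⟩

/-- The opposite algebra. -/
def op (A : AzumayaAlgebra R) : AzumayaAlgebra R :=
  haveI := isAzumaya_op (R := R) A.carrier
  ⟨A.carrierᵐᵒᵖ⟩

/-- Extension of scalars. -/
noncomputable def baseChange (S : Type u) [CommRing S] [Algebra R S] (A : AzumayaAlgebra R) :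
    AzumayaAlgebra S :=
  haveI := isAzumaya_baseChange (R := R) S A.carrier
  ⟨S ⊗[R] A.carrier⟩

/-- The underlying module of an Azumaya algebra is finitely generated faithful projective. -/
def toFaithfulProjective (A : AzumayaAlgebra R) : FaithfulProjective R :=
  haveI := faithfullyFlat_of_faithful R A.carrier
  ⟨A.carrier⟩

/-- Brauer equivalence: `A ⊗ End P ≃ B ⊗ End Q` for some finitely generated faithful projective
modules `P`, `Q`. -/
def BrauerEquiv (A B : AzumayaAlgebra R) : Prop :=
  ∃ P Q : FaithfulProjective R, Nonempty (A.carrier ⊗[R] P.E ≃ₐ[R] B.carrier ⊗[R] Q.E)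

theorem brauerEquiv_of_algEquiv {A B : AzumayaAlgebra R} (e : A.carrier ≃ₐ[R] B.carrier) :
    BrauerEquiv A B :=
  ⟨.self R, .self R, ⟨Algebra.TensorProduct.congr e AlgEquiv.refl⟩⟩

theorem BrauerEquiv.symm {A B : AzumayaAlgebra R} : BrauerEquiv A B → BrauerEquiv B A :=
  fun ⟨P, Q, ⟨e⟩⟩ => ⟨Q, P, ⟨e.symm⟩⟩

/-- `X ⊗ End (P ⊗ Q) ≃ (X ⊗ End P) ⊗ End Q`. -/
noncomputable def tensorEndTensor (X : Type u) [Ring X] [Algebra R X]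
    (P Q : FaithfulProjective R) :
    X ⊗[R] (P.tensor Q).E ≃ₐ[R] (X ⊗[R] P.E) ⊗[R] Q.E :=
  (Algebra.TensorProduct.congr AlgEquiv.refl (endTensorEnd R P.carrier Q.carrier).symm).trans
    (Algebra.TensorProduct.assoc R R R X P.E Q.E).symm

/-- `(X ⊗ Y) ⊗ Z ≃ (X ⊗ Z) ⊗ Y`. -/
noncomputable def rightComm (X Y Z : Type u) [Ring X] [Algebra R X] [Ring Y] [Algebra R Y]
    [Ring Z] [Algebra R Z] : (X ⊗[R] Y) ⊗[R] Z ≃ₐ[R] (X ⊗[R] Z) ⊗[R] Y :=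
  (Algebra.TensorProduct.assoc R R R X Y Z).trans <|
    (Algebra.TensorProduct.congr AlgEquiv.refl (Algebra.TensorProduct.comm R Y Z)).trans
      (Algebra.TensorProduct.assoc R R R X Z Y).symm

theorem BrauerEquiv.trans {A B C : AzumayaAlgebra R} :
    BrauerEquiv A B → BrauerEquiv B C → BrauerEquiv A C := by
  rintro ⟨P, Q, ⟨e⟩⟩ ⟨P', Q', ⟨f⟩⟩
  refine ⟨P.tensor P', Q'.tensor Q, ⟨?_⟩⟩
  exact (tensorEndTensor A.carrier P P').trans <|
    (Algebra.TensorProduct.congr e AlgEquiv.refl).trans <|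
    (rightComm B.carrier Q.E P'.E).trans <|
    (Algebra.TensorProduct.congr f AlgEquiv.refl).trans <|
    (tensorEndTensor C.carrier Q' Q).symm

/-- Brauer equivalence is an equivalence relation. -/
def brauerSetoid (R : Type u) [CommRing R] : Setoid (AzumayaAlgebra R) where
  r := BrauerEquiv
  iseqv := ⟨fun _ => brauerEquiv_of_algEquiv AlgEquiv.refl, .symm, .trans⟩

theorem BrauerEquiv.tensor {A A' B B' : AzumayaAlgebra R} :
    BrauerEquiv A A' → BrauerEquiv B B' → BrauerEquiv (A.tensor B) (A'.tensor B') := by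
  rintro ⟨P, Q, ⟨e⟩⟩ ⟨P', Q', ⟨f⟩⟩
  refine ⟨P.tensor P', Q.tensor Q', ⟨?_⟩⟩
  exact (Algebra.TensorProduct.congr AlgEquiv.refl
      (endTensorEnd R P.carrier P'.carrier).symm).trans <|
    (Algebra.TensorProduct.tensorTensorTensorComm R R R R A.carrier B.carrier P.E P'.E).trans <|
    (Algebra.TensorProduct.congr e f).trans <|
    (Algebra.TensorProduct.tensorTensorTensorComm R R R R A'.carrier Q.E B'.carrier Q'.E).trans <|
    Algebra.TensorProduct.congr AlgEquiv.refl (endTensorEnd R Q.carrier Q'.carrier)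

/-- `A ⊗ End P ≃ B ⊗ End Q` is preserved by extension of scalars. -/
theorem BrauerEquiv.baseChange (S : Type u) [CommRing S] [Algebra R S] {A A' : AzumayaAlgebra R} :
    BrauerEquiv A A' → BrauerEquiv (A.baseChange S) (A'.baseChange S) := by
  rintro ⟨P, Q, ⟨e⟩⟩
  refine ⟨P.baseChange S, Q.baseChange S, ⟨?_⟩⟩
  exact (Algebra.TensorProduct.congr AlgEquiv.refl (baseChangeEnd R S P.carrier).symm).trans <|
    (baseChangeTensor (R := R) S A.carrier P.E).trans <|
    (Algebra.TensorProduct.congr (AlgEquiv.refl (R := S) (A₁ := S)) e).trans <|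
    (baseChangeTensor (R := R) S A'.carrier Q.E).symm.trans <|
    Algebra.TensorProduct.congr AlgEquiv.refl (baseChangeEnd R S Q.carrier)

/-- `A ⊗ Aᵐᵒᵖ ≃ End A` is Brauer equivalent to `R`. -/
theorem brauerEquiv_op_tensor (A : AzumayaAlgebra R) :
    BrauerEquiv (A.op.tensor A) (.self R) := by
  refine ⟨.self R, A.toFaithfulProjective, ⟨?_⟩⟩
  exact (Algebra.TensorProduct.congr AlgEquiv.refl (AlgEquiv.moduleEndSelf R).symm).trans <|
    (Algebra.TensorProduct.congr AlgEquiv.refl (AlgEquiv.toOpposite R R).symm).trans <|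
    (Algebra.TensorProduct.rid R R _).trans <|
    (Algebra.TensorProduct.comm R _ _).trans <|
    (AlgEquiv.ofBijective (AlgHom.mulLeftRight R A.carrier) IsAzumaya.bij).trans
    (Algebra.TensorProduct.lid R _).symm

end AzumayaAlgebra

/-- The Brauer group of a commutative ring: Azumaya algebras up to Brauer equivalence. -/
def Br (R : Type u) [CommRing R] : Type (u + 1) := Quotient (AzumayaAlgebra.brauerSetoid R)

namespace Br
open AzumayaAlgebra

/-- The class of an Azumaya algebra. -/
def mk (A : AzumayaAlgebra R) : Br R := Quotient.mk _ A

theorem mk_eq_mk {A B : AzumayaAlgebra R} (e : A.carrier ≃ₐ[R] B.carrier) : mk A = mk B :=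
  Quotient.sound (brauerEquiv_of_algEquiv e)

instance : Zero (Br R) := ⟨mk (.self R)⟩

noncomputable instance : Add (Br R) :=
  ⟨Quotient.map₂ AzumayaAlgebra.tensor fun _ _ h _ _ h' => h.tensor h'⟩

theorem mk_add (A B : AzumayaAlgebra R) : mk A + mk B = mk (A.tensor B) := rfl

noncomputable instance : AddCommMonoid (Br R) where
  add_assoc := by
    rintro ⟨A⟩ ⟨B⟩ ⟨C⟩
    exact mk_eq_mk (Algebra.TensorProduct.assoc R R R A.carrier B.carrier C.carrier)
  zero_add := by
    rintro ⟨A⟩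
    exact mk_eq_mk (Algebra.TensorProduct.lid R A.carrier)
  add_zero := by
    rintro ⟨A⟩
    exact mk_eq_mk (Algebra.TensorProduct.rid R R A.carrier)
  add_comm := by
    rintro ⟨A⟩ ⟨B⟩
    exact mk_eq_mk (Algebra.TensorProduct.comm R A.carrier B.carrier)
  nsmul := nsmulRec

theorem op_add_mk (A : AzumayaAlgebra R) : mk A.op + mk A = 0 :=
  Quotient.sound (brauerEquiv_op_tensor A)

/-- The inverse of the class of `A` is the class of the opposite algebra. -/
noncomputable instance : Neg (Br R) :=
  ⟨Quotient.lift (fun A => mk A.op) fun A B h => by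
    have h' : mk A = mk B := Quotient.sound h
    exact left_neg_eq_right_neg (op_add_mk A) (by rw [add_comm, h', op_add_mk])⟩

noncomputable instance : AddCommGroup (Br R) where
  zsmul := zsmulRec
  neg_add_cancel := by
    rintro ⟨A⟩
    exact op_add_mk A
  add_comm := add_comm

/-- The homomorphism `Br R → Br S` given by extension of scalars along `f : R → S`. -/
noncomputable def map {S : Type u} [CommRing S] (f : R →+* S) : Br R →+ Br S :=
  letI := f.toAlgebra
  { toFun := Quotient.map (AzumayaAlgebra.baseChange S) fun _ _ h => h.baseChange S
    map_zero' := mk_eq_mk (Algebra.TensorProduct.rid R S S)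
    map_add' := by
      rintro ⟨A⟩ ⟨B⟩
      exact mk_eq_mk (baseChangeTensor S A.carrier B.carrier).symm }

end Br

end brauer

section quaternion
variable {R : Type u} [CommRing R]

/-- The quaternion algebra `(a, b)` over `R`: generators `i`, `j` with `i ^ 2 = a`, `j ^ 2 = b`,
`i * j = - j * i`. -/
abbrev Quat (a b : R) : Type u := QuaternionAlgebra R a 0 b

theorem quat_proj (a b a' b' t' : R) (ha : a * a' = 1) (hb : b * b' = 1) (ht : 2 * t' = 1)
    (x : Quat a b) :
    (t' * t') • (x + a' • ((⟨0, 1, 0, 0⟩ : Quat a b) * x * ⟨0, 1, 0, 0⟩)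
      + b' • ((⟨0, 0, 1, 0⟩ : Quat a b) * x * ⟨0, 0, 1, 0⟩)
      - (a' * b') • ((⟨0, 0, 0, 1⟩ : Quat a b) * x * ⟨0, 0, 0, 1⟩)) = ⟨x.re, 0, 0, 0⟩ := by
  ext
  · simp
    linear_combination (t' * t' * x.re) * (ha * (1 + b * b') + hb * 2) + (x.re * (2 * t' + 1)) * ht
  · simp
    linear_combination (t' * t' * x.imI) * (ha * (1 - b * b') - 2 * hb)
  · simp
    linear_combination (t' * t' * x.imJ) * (hb * (1 - a * a') - 2 * ha)
  · simp
    linear_combination (t' * t' * x.imK) * (ha * (-1 + b * b'))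

theorem quat_decomp (a b a' b' : R) (ha : a * a' = 1) (hb : b * b' = 1)
    (f : Module.End R (Quat a b)) (x : Quat a b) :
    f 1 * (⟨x.re, 0, 0, 0⟩ : Quat a b)
      + f ⟨0, 1, 0, 0⟩ * (⟨((a' • ⟨0, 1, 0, 0⟩ : Quat a b) * x).re, 0, 0, 0⟩ : Quat a b)
      + f ⟨0, 0, 1, 0⟩ * (⟨((b' • ⟨0, 0, 1, 0⟩ : Quat a b) * x).re, 0, 0, 0⟩ : Quat a b)
      + f ⟨0, 0, 0, 1⟩ * (⟨((-(a' * b') • ⟨0, 0, 0, 1⟩ : Quat a b) * x).re, 0, 0, 0⟩ : Quat a b)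
    = f x := by
  have hq : ∀ (r : R) (y : Quat a b), y * (⟨r, 0, 0, 0⟩ : Quat a b) = r • y := by
    intro r y
    ext <;> simp [mul_comm]
  have hx : x = x.re • (1 : Quat a b) + x.imI • (⟨0, 1, 0, 0⟩ : Quat a b)
      + x.imJ • (⟨0, 0, 1, 0⟩ : Quat a b) + x.imK • (⟨0, 0, 0, 1⟩ : Quat a b) := by
    ext <;> simp
  have h1 : ((a' • ⟨0, 1, 0, 0⟩ : Quat a b) * x).re = x.imI := by
    simp
    linear_combination x.imI * ha
  have h2 : ((b' • ⟨0, 0, 1, 0⟩ : Quat a b) * x).re = x.imJ := by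
    simp
    linear_combination x.imJ * hb
  have h3 : ((-(a' * b') • ⟨0, 0, 0, 1⟩ : Quat a b) * x).re = x.imK := by
    simp
    linear_combination x.imK * (ha * b * b' + hb)
  rw [h1, h2, h3]
  conv_rhs => rw [hx]
  simp only [map_add, map_smul, hq]

theorem isAzumaya_quat (h2 : IsUnit (2 : R)) (a b : Rˣ) : IsAzumaya R (Quat (a : R) (b : R)) := by
  obtain ⟨t', ht⟩ := h2.exists_right_inv
  obtain ⟨a', ha⟩ := a.isUnit.exists_right_inv
  obtain ⟨b', hb⟩ := b.isUnit.exists_right_inv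
  let I : Quat (a : R) (b : R) := ⟨0, 1, 0, 0⟩
  let J : Quat (a : R) (b : R) := ⟨0, 0, 1, 0⟩
  let K : Quat (a : R) (b : R) := ⟨0, 0, 0, 1⟩
  let T : Quat (a : R) (b : R) ⊗[R] (Quat (a : R) (b : R))ᵐᵒᵖ := (t' * t') • (1 ⊗ₜ 1
    + a' • (I ⊗ₜ MulOpposite.op I) + b' • (J ⊗ₜ MulOpposite.op J)
    - (a' * b') • (K ⊗ₜ MulOpposite.op K))
  have hT : ∀ x, AlgHom.mulLeftRight R (Quat (a : R) (b : R)) T x = ⟨x.re, 0, 0, 0⟩ := by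
    intro x
    rw [← quat_proj (a : R) b a' b' t' ha hb ht x]
    simp only [T, map_smul, map_add, map_sub, LinearMap.smul_apply, LinearMap.add_apply,
      LinearMap.sub_apply, AlgHom.mulLeftRight_apply, MulOpposite.unop_op, MulOpposite.unop_one,
      mul_one, one_mul, I, J, K]
  have hs : Function.Surjective (AlgHom.mulLeftRight R (Quat (a : R) (b : R))) := by
    intro f
    refine ⟨(f 1 ⊗ₜ 1) * T + (f I ⊗ₜ 1) * (T * ((a' • I) ⊗ₜ 1))
      + (f J ⊗ₜ 1) * (T * ((b' • J) ⊗ₜ 1))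
      + (f K ⊗ₜ 1) * (T * ((-(a' * b') • K) ⊗ₜ 1)), ?_⟩
    ext1 x
    rw [← quat_decomp (a : R) b a' b' ha hb f x]
    simp only [map_add, map_mul, LinearMap.add_apply, Module.End.mul_apply, hT,
      AlgHom.mulLeftRight_apply, MulOpposite.unop_one, mul_one, I, J, K]
  refine { bij := ⟨?_, hs⟩, eq_of_smul_eq_smul := ?_ }
  · intro r s h
    have := congrArg QuaternionAlgebra.re (h (1 : Quat (a : R) (b : R)))
    simpa using this
  · let B := QuaternionAlgebra.basisOneIJK (a : R) 0 (b : R)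
    let e : (Quat (a : R) (b : R) ⊗[R] (Quat (a : R) (b : R))ᵐᵒᵖ) ≃ₗ[R]
        Module.End R (Quat (a : R) (b : R)) :=
      (B.tensorProduct (B.map (MulOpposite.opLinearEquiv R))).equivFun.trans
        (((Matrix.toLin B B).symm.trans (LinearEquiv.curry R R _ _).symm).symm)
    have := OrzechProperty.injective_of_surjective_endomorphism
      (e.symm.toLinearMap ∘ₗ (AlgHom.mulLeftRight R (Quat (a : R) (b : R))).toLinearMap)
      (e.symm.surjective.comp hs)
    exact Function.Injective.of_comp (f := e.symm) this

theorem isUnit_two_of_algebraRat [Algebra ℚ R] : IsUnit (2 : R) := by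
  have := (IsUnit.mk0 (2 : ℚ) two_ne_zero).map (algebraMap ℚ R)
  rwa [map_ofNat] at this

/-- The quaternion algebra `(a, b)`, for units `a`, `b` of a `ℚ`-algebra, as an Azumaya algebra. -/
def quatAzumaya [Algebra ℚ R] (a b : Rˣ) : AzumayaAlgebra R :=
  haveI := isAzumaya_quat (R := R) isUnit_two_of_algebraRat a b
  ⟨Quat (a : R) (b : R)⟩

/-- The class of the quaternion algebra `(a, b)` in the Brauer group. -/
def quatClass [Algebra ℚ R] (a b : Rˣ) : Br R := Br.mk (quatAzumaya a b)

theorem two_nsmul_quatClass [Algebra ℚ R] (a b : Rˣ) : 2 • quatClass a b = 0 := by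
  have h : quatClass a b = Br.mk (quatAzumaya a b).op :=
    Br.mk_eq_mk (QuaternionAlgebra.starAe (R := R) (c₁ := (a : R)) (c₂ := 0) (c₃ := (b : R)))
  rw [two_nsmul]
  nth_rw 1 [h]
  exact Br.op_add_mk _

end quaternion

/-- The `2`-torsion subgroup of the Brauer group. -/
noncomputable def Br2 (R : Type u) [CommRing R] : AddSubgroup (Br R) :=
  (nsmulAddMonoidHom 2).ker

/-- The map on `2`-torsion classes given by extension of scalars along `f`. -/
noncomputable def Br2.map {R S : Type u} [CommRing R] [CommRing S] (f : R →+* S) (β : Br2 R) :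
    Br2 S :=
  ⟨Br.map f β, by
    have h : 2 • (β : Br R) = 0 := β.2
    change 2 • Br.map f β = 0
    rw [← map_nsmul, h, map_zero]⟩

/-- The local invariant of a `2`-torsion class over a local field `K` (here `K = ℚ_p` or `K = ℝ`),
in `ℚ / ℤ`. The invariant map is injective on `Br K`, so it sends the trivial class to `0` and any
nontrivial class of order `2` to the unique element `1 / 2` of order `2`. -/
noncomputable def localInv (K : Type u) [Field K] (β : Br2 K) : AddCircle (1 : ℚ) :=
  open Classical in if β = 0 then 0 else ((1 / 2 : ℚ) : AddCircle (1 : ℚ))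

end BrauerAz

/-! ### The surface -/

namespace MarkoffK3
open BrauerAz MvPolynomial

/-- The polynomial
`x² + y² + z² - 4 (x² y² + y² z² + z² x²) + 16 x² y² z² - k`. -/
noncomputable def F (k : ℤ) (R : Type) [CommRing R] : MvPolynomial (Fin 3) R :=
  X 0 ^ 2 + X 1 ^ 2 + X 2 ^ 2
    - 4 * (X 0 ^ 2 * X 1 ^ 2 + X 1 ^ 2 * X 2 ^ 2 + X 2 ^ 2 * X 0 ^ 2)
    + 16 * (X 0 ^ 2 * X 1 ^ 2 * X 2 ^ 2) - (k : MvPolynomial (Fin 3) R)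

/-- The coordinate ring `R[x, y, z] / (F)`. The affine surface `U_k` over `ℚ` is the spectrum of
`CoordRing k ℚ`, and its integral model is the spectrum of `CoordRing k ℤ`. -/
abbrev CoordRing (k : ℤ) (R : Type) [CommRing R] : Type :=
  MvPolynomial (Fin 3) R ⧸ Ideal.span {F k R}

/-- The points of the surface with coordinates in `S`. -/
@[ext] structure Pt (k : ℤ) (S : Type) [CommRing S] where
  x : S
  y : S
  z : S
  eqn : x ^ 2 + y ^ 2 + z ^ 2 - 4 * (x ^ 2 * y ^ 2 + y ^ 2 * z ^ 2 + z ^ 2 * x ^ 2)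
    + 16 * (x ^ 2 * y ^ 2 * z ^ 2) = (k : S)

/-- The image of a point under a ring homomorphism. -/
def Pt.map {k : ℤ} {S T : Type} [CommRing S] [CommRing T] (f : S →+* T) (P : Pt k S) : Pt k T where
  x := f P.x
  y := f P.y
  z := f P.z
  eqn := by
    have h := congrArg f P.eqn
    simpa only [map_add, map_sub, map_mul, map_pow, map_intCast, map_ofNat] using h

/-- Evaluation of regular functions at a point. -/
noncomputable def Pt.evalHom {k : ℤ} {K : Type} [CommRing K] [Algebra ℚ K] (P : Pt k K) :
    CoordRing k ℚ →+* K :=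
  Ideal.Quotient.lift _ (aeval (R := ℚ) ![P.x, P.y, P.z]).toRingHom <| by
    intro a ha
    obtain ⟨c, rfl⟩ := Ideal.mem_span_singleton'.1 ha
    have h : aeval (R := ℚ) ![P.x, P.y, P.z] (F k ℚ) = 0 := by
      simp only [F, map_sub, map_add, map_mul, map_pow, aeval_X, map_intCast, map_ofNat]
      simpa [sub_eq_zero] using P.eqn
    change aeval (R := ℚ) ![P.x, P.y, P.z] (c * F k ℚ) = 0
    rw [map_mul, h, mul_zero]

/-- The coordinate functions `x`, `y`, `z` on `U_k`. -/
noncomputable def coord (k : ℤ) (i : Fin 3) : CoordRing k ℚ := Ideal.Quotient.mk _ (X i)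

theorem coord_eqn (k : ℤ) :
    (4 * coord k 0 ^ 2 - 1) * (4 * coord k 1 ^ 2 - 1) * (4 * coord k 2 ^ 2 - 1)
      = algebraMap ℚ (CoordRing k ℚ) (4 * k - 1) := by
  have h0 : Ideal.Quotient.mk (Ideal.span {F k ℚ}) (F k ℚ) = 0 :=
    Ideal.Quotient.eq_zero_iff_mem.2 (Ideal.mem_span_singleton_self _)
  have h : coord k 0 ^ 2 + coord k 1 ^ 2 + coord k 2 ^ 2
      - 4 * (coord k 0 ^ 2 * coord k 1 ^ 2 + coord k 1 ^ 2 * coord k 2 ^ 2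
        + coord k 2 ^ 2 * coord k 0 ^ 2)
      + 16 * (coord k 0 ^ 2 * coord k 1 ^ 2 * coord k 2 ^ 2) - (k : CoordRing k ℚ) = 0 := by
    rw [← h0]
    conv_rhs => arg 2; rw [F]
    simp only [map_sub, map_add, map_mul, map_pow, map_intCast, map_ofNat, coord]
  simp only [map_sub, map_mul, map_intCast, map_ofNat, map_one]
  linear_combination 4 * h

theorem isUnit_coord (k : ℤ) (i : Fin 3) : IsUnit (4 * coord k i ^ 2 - 1) := by
  have h0 : (4 * k - 1 : ℚ) ≠ 0 := by
    have : (4 * k - 1 : ℤ) ≠ 0 := by omega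
    exact_mod_cast this
  have h := (IsUnit.mk0 _ h0).map (algebraMap ℚ (CoordRing k ℚ))
  rw [← coord_eqn] at h
  have h12 := isUnit_of_mul_isUnit_left h
  fin_cases i
  · exact isUnit_of_mul_isUnit_left h12
  · exact isUnit_of_mul_isUnit_right h12
  · exact isUnit_of_mul_isUnit_right h

/-- The invertible function `4 x_i ^ 2 - 1` on `U_k`. -/
noncomputable def coordUnit (k : ℤ) (i : Fin 3) : (CoordRing k ℚ)ˣ := (isUnit_coord k i).unit

/-- The invertible constant function `k ≠ 0` on `U_k`. -/
noncomputable def constUnit (k : ℤ) (hk : k ≠ 0) : (CoordRing k ℚ)ˣ :=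
  Units.map (algebraMap ℚ (CoordRing k ℚ)).toMonoidHom (Units.mk0 (k : ℚ) (by exact_mod_cast hk))

/-- The class of the quaternion algebra `(4 x_i ^ 2 - 1, k)` in the `2`-torsion of `Br U_k`. -/
noncomputable def 𝒜 (k : ℤ) (hk : k ≠ 0) (i : Fin 3) : Br2 (CoordRing k ℚ) :=
  ⟨quatClass (coordUnit k i) (constUnit k hk), two_nsmul_quatClass _ _⟩

/-- `Br₀ U_k`, the image of `Br ℚ` in `Br U_k`. -/
noncomputable def brauer0 (k : ℤ) : AddSubgroup (Br (CoordRing k ℚ)) :=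
  (Br.map (algebraMap ℚ (CoordRing k ℚ))).range

/-- The natural map from the coordinate ring over `ℚ` to that over the algebraic closure of `ℚ`. -/
noncomputable def toAlgClosure (k : ℤ) : CoordRing k ℚ →+* CoordRing k (AlgebraicClosure ℚ) :=
  Ideal.quotientMap _ (MvPolynomial.map (algebraMap ℚ (AlgebraicClosure ℚ))) <| by
    rw [Ideal.span_le, Set.singleton_subset_iff]
    have : MvPolynomial.map (algebraMap ℚ (AlgebraicClosure ℚ)) (F k ℚ)
        = F k (AlgebraicClosure ℚ) := by
      simp [F]
    rw [SetLike.mem_coe, Ideal.mem_comap, this]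
    exact Ideal.mem_span_singleton_self _

/-- The algebraic Brauer group `Br₁ U_k`, the kernel of `Br U_k → Br (U_k ⊗ ℚ̄)`. -/
noncomputable def brauer1 (k : ℤ) : AddSubgroup (Br (CoordRing k ℚ)) :=
  (Br.map (toAlgClosure k)).ker

/-- The subgroup `Br₁ U_k / Br₀ U_k` of `Br U_k / Br₀ U_k`. -/
noncomputable def brauer1Quot (k : ℤ) : AddSubgroup (Br (CoordRing k ℚ) ⧸ brauer0 k) :=
  (brauer1 k).map (QuotientAddGroup.mk' (brauer0 k))

/-- The subgroup of `Br U_k / Br₀ U_k` generated by the classes of `(4 x ^ 2 - 1, k)` and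
`(4 y ^ 2 - 1, k)`. -/
noncomputable def subgroupA (k : ℤ) (hk : k ≠ 0) : AddSubgroup (Br (CoordRing k ℚ) ⧸ brauer0 k) :=
  AddSubgroup.closure {QuotientAddGroup.mk' (brauer0 k) (𝒜 k hk 0 : Br (CoordRing k ℚ)),
    QuotientAddGroup.mk' (brauer0 k) (𝒜 k hk 1 : Br (CoordRing k ℚ))}

/-- The local invariant at the prime `p` of a `2`-torsion class of `Br U_k` at a `p`-adic integral
point. -/
noncomputable def invPadic {k : ℤ} (p : ℕ) [Fact p.Prime] (β : Br2 (CoordRing k ℚ))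
    (P : Pt k ℤ_[p]) : AddCircle (1 : ℚ) :=
  localInv ℚ_[p] (Br2.map (P.map (PadicInt.Coe.ringHom (p := p))).evalHom β)

/-- The local invariant at the real place of a `2`-torsion class of `Br U_k` at a real point. -/
noncomputable def invReal {k : ℤ} (β : Br2 (CoordRing k ℚ)) (P : Pt k ℝ) : AddCircle (1 : ℚ) :=
  localInv ℝ (Br2.map P.evalHom β)

/-- The set of adelic integral points: the product of the sets of `ℤ_p`-points over all primes `p`
and of the set of real points. -/
structure AdelicPt (k : ℤ) where
  padic : ∀ (p : ℕ) [Fact p.Prime], Pt k ℤ_[p]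
  real : Pt k ℝ

/-- The diagonal embedding of the integral points in the adelic integral points. -/
noncomputable def diag {k : ℤ} (P : Pt k ℤ) : AdelicPt k where
  padic p _ := P.map (Int.castRingHom ℤ_[p])
  real := P.map (Int.castRingHom ℝ)

/-- The Brauer--Manin pairing of an adelic integral point with a `2`-torsion class, the sum of the
local invariants over all places (only finitely many of them are nonzero). -/
noncomputable def pairing {k : ℤ} (P : AdelicPt k) (β : Br2 (CoordRing k ℚ)) :
    AddCircle (1 : ℚ) :=
  (∑ᶠ p : Nat.Primes,
    haveI : Fact (p : ℕ).Prime := ⟨p.2⟩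
    invPadic (p : ℕ) β (P.padic p)) + invReal β P.real

/-- The integral Brauer--Manin set for a subgroup `A` of `Br U_k / Br₀ U_k` that is generated by
images of `2`-torsion classes: the adelic integral points orthogonal to all `2`-torsion classes in
`Br U_k` whose image in `Br U_k / Br₀ U_k` lies in `A`. Lifts of the same element of `A` differ by
constant classes, which are orthogonal to everything by reciprocity. -/
def brauerManinSet (k : ℤ) (A : AddSubgroup (Br (CoordRing k ℚ) ⧸ brauer0 k)) :
    Set (AdelicPt k) :=
  {P | ∀ β : Br2 (CoordRing k ℚ),
    QuotientAddGroup.mk' (brauer0 k) (β : Br (CoordRing k ℚ)) ∈ A → pairing P β = 0}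

end MarkoffK3

/-! The equation is equivalent to `(4x² - 1)(4y² - 1)(4z² - 1) = 4k - 1`, and `k = 2(3ℓ)²` has the
square class of `2`. At a point, each of the two algebras therefore specialises to `(4t² - 1, 2)`,
where `t` is the relevant coordinate.

At the real place `k > 0` is a square, so the class splits. At an odd prime `p` there are two cases
(`invPadic_eq_zero`). If `2` is a square modulo `p`, then `k` is a square in `ℤ_p`. If not, `p`
cannot divide `4k - 1`, since `2(6ℓ)² ≡ 1` would make `2` a square; so the factor `4t² - 1` is a
unit, hence a norm from the unramified extension `ℚ_p(√2)`. At `2` (`invPadic_two`), an odd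
coordinate gives `4t² - 1 ≡ 3` modulo `8`, and the Hilbert symbol `(3, 2)` is nontrivial; if `x` and
`y` are both even, then `z² ≡ k ≡ 2` modulo `4`, which is impossible. So every adelic point pairs to
`1/2` with one of the generators.

On the algebraic side this needs that `(a, b)` splits when `a` is a norm from `R[√b]`
(`quatClass_eq_zero`), and that over a field it is nontrivial when `b` is not a square and `a` is
not a norm (`quatClass_ne_zero`, via `mk_ne_zero`).

Local points are explicit at `2`, at `3` and wherever `2` is a square. At the other primes
`ZMod.exists_one_sub_sq_mul` gives a point modulo `p`, which lifts by Hensel. The absence of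
integral points is proved by an elementary form of the same argument, so the inclusion in the
Brauer–Manin set needs no reciprocity law. -/

namespace BrauerAz
open scoped TensorProduct
universe u
-- Split quaternion algebras over a commutative ring.
section splitting
variable {R : Type u} [CommRing R]

/-- Generators of `M₂(R)` that exhibit it as the quaternion algebra `(u ^ 2 - b v ^ 2, b)`. -/
def quatMatrixBasis (a b u v : R) (h : a = u ^ 2 - b * v ^ 2) :
    QuaternionAlgebra.Basis (Matrix (Fin 2) (Fin 2) R) a 0 b where
  i := !![u, -(b * v); v, -u]
  j := !![0, b; 1, 0]
  k := !![-(b * v), u * b; -u, b * v]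
  i_mul_i := by
    subst h
    ext i j
    fin_cases i <;> fin_cases j <;> simp [Matrix.mul_apply, Fin.sum_univ_two] <;> ring
  j_mul_j := by
    ext i j
    fin_cases i <;> fin_cases j <;> simp [Matrix.mul_apply, Fin.sum_univ_two]
  i_mul_j := by
    ext i j
    fin_cases i <;> fin_cases j <;> simp [Matrix.mul_apply, Fin.sum_univ_two, mul_comm]
  j_mul_i := by
    ext i j
    fin_cases i <;> fin_cases j <;> simp [Matrix.mul_apply, Fin.sum_univ_two]; ring

/-- A quaternion algebra `(a, b)` with `a` a norm from `R[√b]` is a matrix algebra. -/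
theorem quat_algEquiv_matrix (h2 : IsUnit (2 : R)) (a b : Rˣ) (u v : R)
    (h : (a : R) = u ^ 2 - b * v ^ 2) :
    Nonempty (Quat (a : R) (b : R) ≃ₐ[R] Matrix (Fin 2) (Fin 2) R) := by
  obtain ⟨t, ht⟩ := h2.exists_right_inv
  obtain ⟨a', ha⟩ := a.isUnit.exists_right_inv
  obtain ⟨b', hb⟩ := b.isUnit.exists_right_inv
  let q := quatMatrixBasis (a : R) b u v h
  have hq : ∀ x, q.liftHom x = !![x.re + x.imI * u - x.imK * (b * v),
      -(x.imI * (b * v)) + x.imJ * b + x.imK * (u * b);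
      x.imI * v + x.imJ - x.imK * u, x.re - x.imI * u + x.imK * (b * v)] := by
    intro x
    ext i j
    fin_cases i <;> fin_cases j <;>
      simp [q, quatMatrixBasis, QuaternionAlgebra.Basis.liftHom, QuaternionAlgebra.Basis.lift,
        Matrix.algebraMap_matrix_apply] <;> ring
  refine ⟨AlgEquiv.ofBijective q.liftHom ⟨?_, ?_⟩⟩
  · rw [injective_iff_map_eq_zero]
    intro x hx
    rw [hq] at hx
    have h00 := congrFun (congrFun hx 0) 0
    have h01 := congrFun (congrFun hx 0) 1
    have h10 := congrFun (congrFun hx 1) 0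
    have h11 := congrFun (congrFun hx 1) 1
    simp at h00 h01 h10 h11
    ext <;> simp
    · linear_combination t * h00 + t * h11 - x.re * ht
    · linear_combination t * a' * (u * (h00 - h11) + v * (h01 - b * h10))
        - x.imI * a * a' * ht - x.imI * ha + 2 * t * a' * x.imI * h
    · linear_combination t * h10 + t * b' * h01 - x.imJ * ht
        - t * (-x.imI * v + x.imJ + x.imK * u) * hb
    · linear_combination t * a' * (v * (h00 - h11) + u * b' * (h01 - b * h10))
        - x.imK * a * a' * ht - x.imK * ha + 2 * t * a' * x.imK * h
        - 2 * t * a' * u * (u * x.imK - v * x.imI) * hb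
  · intro m
    -- The preimage solves the linear system read off from `hq`: sums and differences of entries
    -- isolate `re`, `imJ` and the pair `(imI, imK)`, and only `2`, `b` and `a = u² - bv²` have to
    -- be inverted.
    refine ⟨⟨t * (m 0 0 + m 1 1), t * a' * (u * (m 0 0 - m 1 1) + v * (m 0 1 - b * m 1 0)),
      t * (m 1 0 + b' * m 0 1),
      t * a' * (v * (m 0 0 - m 1 1) + u * b' * (m 0 1 - b * m 1 0))⟩, ?_⟩
    rw [hq]
    have ht1 : t * a' * (u ^ 2 - b * v ^ 2) = t := by
      rw [← h]
      linear_combination t * ha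
    ext i j
    fin_cases i <;> fin_cases j <;> simp
    · linear_combination m 0 0 * ht + (m 0 0 - m 1 1) * ht1
        - t * a' * u * v * (m 0 1 - b * m 1 0) * hb
    · linear_combination m 0 1 * ht + (m 0 1 - b * m 1 0) * ht1
        + (t * m 0 1 + t * a' * u ^ 2 * (m 0 1 - b * m 1 0)) * hb
    · linear_combination m 1 0 * ht + (b' * m 0 1 - m 1 0) * (-ht1)
        + (t * a' * (u ^ 2 * m 1 0 - v ^ 2 * m 0 1)) * hb
    · linear_combination m 1 1 * ht - (m 0 0 - m 1 1) * ht1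
        + t * a' * u * v * (m 0 1 - b * m 1 0) * hb

theorem mk_eq_zero_of_algEquiv_end (A : AzumayaAlgebra R) (P : FaithfulProjective R)
    (e : A.carrier ≃ₐ[R] P.E) : Br.mk A = 0 := by
  refine Quotient.sound ⟨.self R, P, ⟨?_⟩⟩
  exact (Algebra.TensorProduct.congr e AlgEquiv.refl).trans <|
    (Algebra.TensorProduct.congr AlgEquiv.refl (AlgEquiv.moduleEndSelf R).symm).trans <|
    (Algebra.TensorProduct.congr AlgEquiv.refl (AlgEquiv.toOpposite R R).symm).trans <|
    (Algebra.TensorProduct.rid R R _).trans <|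
    (Algebra.TensorProduct.lid R _).symm

/-- The class of a quaternion algebra `(a, b)` with `a` a norm from `R[√b]` is trivial. -/
theorem quatClass_eq_zero [Algebra ℚ R] (a b : Rˣ) (u v : R) (h : (a : R) = u ^ 2 - b * v ^ 2) :
    quatClass a b = 0 := by
  obtain ⟨e⟩ := quat_algEquiv_matrix isUnit_two_of_algebraRat a b u v h
  have := faithfullyFlat_of_faithful R (Fin 2 → R)
  exact mk_eq_zero_of_algEquiv_end _ ⟨Fin 2 → R⟩ (e.trans Matrix.toLinAlgEquiv')

/-- When `b = c²`, every `a` is a norm: `a = ((a + 1)/2)² - c² ((a - 1)/(2c))²`. In the proof `b' *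
c` plays the role of `1/c`. -/
theorem quatClass_eq_zero_of_sq [Algebra ℚ R] (a b : Rˣ) (c : R) (h : (b : R) = c ^ 2) :
    quatClass a b = 0 := by
  obtain ⟨t, ht⟩ := (isUnit_two_of_algebraRat (R := R)).exists_right_inv
  obtain ⟨b', hb⟩ := b.isUnit.exists_right_inv
  refine quatClass_eq_zero a b ((a + 1) * t) ((a - 1) * t * (b' * c)) ?_
  have h1 : (b : R) * (b' * c) ^ 2 = 1 := by
    rw [mul_pow, ← h]
    linear_combination (b * b' + 1) * hb
  linear_combination ((a - 1) * t) ^ 2 * h1 - a * (2 * t + 1) * ht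
end splitting

/-! ### Quaternion algebras under extension of scalars. -/

section baseChange
variable {R S : Type u} [CommRing R] [CommRing S]

/-- Extension of scalars of a quaternion algebra. -/
noncomputable def baseChangeQuat [Algebra R S] (a b : R) :
    S ⊗[R] Quat a b ≃ₐ[S] Quat (algebraMap R S a) (algebraMap R S b) :=
  AlgEquiv.ofAlgHom
    (Algebra.TensorProduct.lift (Algebra.ofId S _)
      (QuaternionAlgebra.lift (R := R)
        { i := ⟨0, 1, 0, 0⟩
          j := ⟨0, 0, 1, 0⟩
          k := ⟨0, 0, 0, 1⟩
          i_mul_i := by ext <;> simp [Algebra.algebraMap_eq_smul_one]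
          j_mul_j := by ext <;> simp [Algebra.algebraMap_eq_smul_one]
          i_mul_j := by ext <;> simp
          j_mul_i := by ext <;> simp })
      (fun _ _ => Algebra.commutes _ _))
    (QuaternionAlgebra.lift
      { i := 1 ⊗ₜ ⟨0, 1, 0, 0⟩
        j := 1 ⊗ₜ ⟨0, 0, 1, 0⟩
        k := 1 ⊗ₜ ⟨0, 0, 0, 1⟩
        i_mul_i := by
          have : (⟨0, 1, 0, 0⟩ : Quat a b) * ⟨0, 1, 0, 0⟩ = a • 1 := by ext <;> simp
          rw [Algebra.TensorProduct.tmul_mul_tmul, this, TensorProduct.tmul_smul,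
            algebraMap_smul, zero_smul, add_zero, one_mul]
          rfl
        j_mul_j := by
          have : (⟨0, 0, 1, 0⟩ : Quat a b) * ⟨0, 0, 1, 0⟩ = b • 1 := by ext <;> simp
          rw [Algebra.TensorProduct.tmul_mul_tmul, this, TensorProduct.tmul_smul,
            algebraMap_smul, one_mul]
          rfl
        i_mul_j := by
          have : (⟨0, 1, 0, 0⟩ : Quat a b) * ⟨0, 0, 1, 0⟩ = ⟨0, 0, 0, 1⟩ := by ext <;> simp
          rw [Algebra.TensorProduct.tmul_mul_tmul, this, one_mul]
        j_mul_i := by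
          have : (⟨0, 0, 1, 0⟩ : Quat a b) * ⟨0, 1, 0, 0⟩ = -⟨0, 0, 0, 1⟩ := by ext <;> simp
          rw [Algebra.TensorProduct.tmul_mul_tmul, this, one_mul, zero_smul, zero_sub,
            TensorProduct.tmul_neg] })
    (by
      apply QuaternionAlgebra.hom_ext
      · simp [QuaternionAlgebra.lift, QuaternionAlgebra.Basis.liftHom, QuaternionAlgebra.Basis.lift]
      · simp [QuaternionAlgebra.lift, QuaternionAlgebra.Basis.liftHom, QuaternionAlgebra.Basis.lift])
    (by
      apply Algebra.TensorProduct.ext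
      · ext
      apply QuaternionAlgebra.hom_ext
      · simp [QuaternionAlgebra.lift, QuaternionAlgebra.Basis.liftHom, QuaternionAlgebra.Basis.lift]
      · simp [QuaternionAlgebra.lift, QuaternionAlgebra.Basis.liftHom, QuaternionAlgebra.Basis.lift])

theorem map_quatClass [Algebra ℚ R] [Algebra ℚ S] (f : R →+* S) (a b : Rˣ) :
    Br.map f (quatClass a b) = quatClass (Units.map f a) (Units.map f b) :=
  letI := f.toAlgebra
  Br.mk_eq_mk (baseChangeQuat (S := S) (a : R) (b : R))

end baseChange

/-! ### Nontrivial Brauer classes over a field. -/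

section nonsplit
variable {K : Type u} [Field K]

/-- If `D ⊗ End P ≃ End Q`, a rank one idempotent `e` of `End P` has corner `D ⊗ e`, which is
carried to a corner `e' (End Q) e'`. That corner contains a rank one idempotent `g ≠ 0`; since `D`
has only the idempotents `0` and `1`, `g = e'`. So `e'` has rank one, its corner consists of
scalars, and `D` would reduce to `K`. -/
theorem mk_ne_zero (D : AzumayaAlgebra K) (hD : ∀ d : D.carrier, d * d = d → d = 0 ∨ d = 1)
    (hD' : ∃ d : D.carrier, ∀ c : K, d ≠ c • 1) : Br.mk D ≠ 0 := by
  intro h0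
  obtain ⟨P, Q, ⟨f⟩⟩ : D.BrauerEquiv (.self K) := Quotient.exact h0
  let Ψ : D.carrier ⊗[K] P.E ≃ₐ[K] Q.E := f.trans (Algebra.TensorProduct.lid K _)
  have hP : Nontrivial P.carrier := by
    by_contra hP
    rw [not_nontrivial_iff_subsingleton] at hP
    have := (Module.FaithfullyFlat.subsingleton_tensorProduct_iff_left K _).1
      (inferInstance : Subsingleton (K ⊗[K] P.carrier))
    exact not_subsingleton K this
  obtain ⟨p, hp⟩ := exists_ne (0 : P.carrier)
  obtain ⟨φ, hφ⟩ := Module.Projective.exists_dual_eq_one K hp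
  let e : P.E := φ.smulRight p
  have he : ∀ T : P.E, e * T * e = φ (T p) • e := by
    intro T
    ext x
    simp [e, smul_smul, mul_comm]
  have hee : e * e = e := by simpa [hφ] using he 1
  have hinj : ∀ d d' : D.carrier, d ⊗ₜ[K] e = d' ⊗ₜ[K] e → d = d' := by
    intro d d' h
    let L : D.carrier ⊗[K] P.E →ₗ[K] D.carrier := (TensorProduct.rid K D.carrier).toLinearMap ∘ₗ
      (φ ∘ₗ LinearMap.applyₗ p).lTensor D.carrier
    simpa [L, e, hφ] using congrArg L h
  have hcorner : ∀ t : D.carrier ⊗[K] P.E, ∃ d : D.carrier,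
      (1 ⊗ₜ e) * t * (1 ⊗ₜ e) = d ⊗ₜ[K] e := by
    intro t
    induction t with
    | zero => exact ⟨0, by simp⟩
    | add x y hx hy =>
      obtain ⟨d, hd⟩ := hx
      obtain ⟨d', hd'⟩ := hy
      exact ⟨d + d', by rw [mul_add, add_mul, hd, hd', TensorProduct.add_tmul]⟩
    | tmul d T => exact ⟨φ (T p) • d, by simp [he, TensorProduct.smul_tmul]⟩
  have hΨ : ∀ g : Q.E, Ψ (1 ⊗ₜ e) * g * Ψ (1 ⊗ₜ e) = g → ∃ d : D.carrier, g = Ψ (d ⊗ₜ e) := by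
    intro g hg
    obtain ⟨d, hd⟩ := hcorner (Ψ.symm g)
    refine ⟨d, ?_⟩
    rw [← hd]
    simp [hg]
  set e' : Q.E := Ψ (1 ⊗ₜ e) with he'
  have hee' : e' * e' = e' := by rw [he', ← map_mul]; simp [hee]
  have he0' : e' ≠ 0 := by
    intro h
    rw [he', map_eq_zero_iff Ψ Ψ.injective, ← TensorProduct.zero_tmul D.carrier e] at h
    obtain ⟨d, hd⟩ := hD'
    have h1 : (1 : D.carrier) = 0 := hinj _ _ h
    exact hd 0 (by rw [zero_smul, ← mul_one d, h1, mul_zero])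
  obtain ⟨w, hw⟩ : ∃ w, e' w ≠ 0 := by
    by_contra! h
    exact he0' (LinearMap.ext h)
  obtain ⟨ψ, hψ⟩ := Module.Projective.exists_dual_eq_one K hw
  have hew : e' (e' w) = e' w := LinearMap.congr_fun hee' w
  -- This is a rank one idempotent inside the corner of `e'`, because `ψ (e' w) = 1`.
  let g : Q.E := (ψ.comp e').smulRight (e' w)
  have hg : g = e' := by
    obtain ⟨d, hd⟩ := hΨ g (by
      ext x
      have : e' (e' x) = e' x := LinearMap.congr_fun hee' x
      simp [g, hew, this])
    have hgg : g * g = g := by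
      ext x
      simp [g, hew, hψ]
    have hdd : d * d = d := by
      apply hinj
      apply Ψ.injective
      rw [← hd, ← hgg, hd, ← map_mul, Algebra.TensorProduct.tmul_mul_tmul, hee]
    rcases hD d hdd with h | h
    · exfalso
      rw [h, TensorProduct.zero_tmul, map_zero] at hd
      have := LinearMap.congr_fun hd w
      simp [g, hψ] at this
      exact hw this
    · rw [hd, h]
  obtain ⟨d, hd⟩ := hD'
  -- Once `e' = g` has rank one, `e' T e'` is a scalar multiple of `e'` for every `T`.
  have key : Ψ (d ⊗ₜ e) = ψ (Ψ (d ⊗ₜ e) (e' w)) • e' := by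
    have h1 : Ψ (d ⊗ₜ e) = e' * Ψ (d ⊗ₜ e) * e' := by
      rw [he', ← map_mul, ← map_mul]
      simp [hee]
    nth_rw 1 [h1]
    rw [← hg]
    ext x
    have h2 : Ψ (d ⊗ₜ e) (e' w) = e' (Ψ (d ⊗ₜ e) (e' w)) := by
      nth_rw 1 [h1]
      simp [hew]
    simp [g, ← h2, hψ, smul_smul, mul_comm]
  apply hd (ψ (Ψ (d ⊗ₜ e) (e' w)))
  apply hinj
  apply Ψ.injective
  rw [← TensorProduct.smul_tmul', map_smul]
  exact key

/-- The norm form of a quaternion algebra `(a, b)` is anisotropic if `b` is not a square and `a` is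
not a norm from `K(√b)`. -/
theorem quat_norm_anisotropic {a b : K} (hb : ¬ IsSquare b) (h : ∀ u v : K, a ≠ u ^ 2 - b * v ^ 2)
    {r s t w : K} (h0 : r ^ 2 - a * s ^ 2 - b * t ^ 2 + a * b * w ^ 2 = 0) :
    r = 0 ∧ s = 0 ∧ t = 0 ∧ w = 0 := by
  have key : ∀ x y : K, x ^ 2 - b * y ^ 2 = 0 → x = 0 ∧ y = 0 := by
    intro x y hxy
    have hy : y = 0 := by
      by_contra hy
      refine hb ⟨x / y, ?_⟩
      field_simp
      linear_combination -hxy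
    subst hy
    exact ⟨by simpa using hxy, rfl⟩
  -- Otherwise `a` is the quotient of the norms of `r + t√b` and `s + w√b`; the witnesses are the
  -- coordinates of the quotient of these two elements.
  have hN : s ^ 2 - b * w ^ 2 = 0 := by
    by_contra hN
    refine h ((r * s - b * t * w) / (s ^ 2 - b * w ^ 2)) ((t * s - r * w) / (s ^ 2 - b * w ^ 2)) ?_
    field_simp
    linear_combination -(s ^ 2 - b * w ^ 2) * h0
  obtain ⟨rfl, rfl⟩ := key s w hN
  obtain ⟨rfl, rfl⟩ := key r t (by linear_combination h0)
  exact ⟨rfl, rfl, rfl, rfl⟩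

/-- By anisotropy of the norm form, a nonzero idempotent `d` has nonzero norm, and cancelling the
scalar `star d * d` in `star d * d * d = star d * d` gives `d = 1`. The element `i` is not a scalar.
-/
theorem quatClass_ne_zero [Algebra ℚ K] (a b : Kˣ) (hb : ¬ IsSquare (b : K))
    (h : ∀ u v : K, (a : K) ≠ u ^ 2 - b * v ^ 2) : quatClass a b ≠ 0 := by
  refine mk_ne_zero _ ?_ ?_
  · change ∀ d : Quat (a : K) (b : K), d * d = d → d = 0 ∨ d = 1
    intro d hd
    by_cases hN : star d * d = 0
    · left
      have h0 := congrArg QuaternionAlgebra.re hN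
      simp at h0
      obtain ⟨h1, h2, h3, h4⟩ := quat_norm_anisotropic hb h (r := d.re) (s := d.imI) (t := d.imJ)
        (w := d.imK) (by linear_combination h0)
      ext <;> assumption
    · right
      have h1 : star d * d = (star d * d).re • (1 : Quat (a : K) (b : K)) := by
        ext <;> simp <;> ring
      have h2 : (star d * d).re ≠ 0 := by
        intro h2
        rw [h1, h2, zero_smul] at hN
        exact hN rfl
      have h3 : (star d * d) * d = star d * d := by rw [mul_assoc, hd]
      rw [h1, smul_mul_assoc, one_mul] at h3
      exact smul_right_injective _ h2 h3
  · refine ⟨(⟨0, 1, 0, 0⟩ : Quat (a : K) (b : K)), fun c hc => ?_⟩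
    have : (1 : K) = c * 0 := congrArg QuaternionAlgebra.imI hc
    simp at this

end nonsplit
end BrauerAz

/-! ### Squares and norms in the `p`-adic integers. -/

namespace PadicInt
variable {p : ℕ} [Fact p.Prime]

theorem isUnit_iff_toZMod_ne_zero {a : ℤ_[p]} : IsUnit a ↔ toZMod a ≠ 0 := by
  rw [Ne, ← RingHom.mem_ker, ker_toZMod, IsLocalRing.mem_maximalIdeal, mem_nonunits_iff, not_not]

theorem toZMod_surjective : Function.Surjective (toZMod : ℤ_[p] → ZMod p) := fun x =>
  ⟨(x.val : ℤ_[p]), by rw [map_natCast, ZMod.natCast_val, ZMod.cast_id', id]⟩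

theorem zmod_two_ne_zero (hp : p ≠ 2) : (2 : ZMod p) ≠ 0 := by
  intro h
  have h' : ((2 : ℕ) : ZMod p) = 0 := by exact_mod_cast h
  rw [ZMod.natCast_eq_zero_iff] at h'
  exact hp ((Nat.prime_dvd_prime_iff_eq Fact.out Nat.prime_two).1 h')

/-- For odd `p`, a `p`-adic unit that is a square modulo `p` is a square. -/
theorem exists_sq_of_toZMod (hp : p ≠ 2) (a : ℤ_[p]) (c : ZMod p) (hc : c ≠ 0)
    (h : toZMod a = c ^ 2) : ∃ z : ℤ_[p], z ^ 2 = a := by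
  obtain ⟨d, rfl⟩ := toZMod_surjective c
  have hd : ‖(Polynomial.X ^ 2 - Polynomial.C a).aeval d‖ <
      ‖(Polynomial.X ^ 2 - Polynomial.C a).derivative.aeval d‖ ^ 2 := by
    have h1 : IsUnit (2 * d) := by
      rw [isUnit_iff_toZMod_ne_zero, map_mul, map_ofNat]
      exact mul_ne_zero (zmod_two_ne_zero hp) hc
    have h2 : ¬ IsUnit (d ^ 2 - a) := by
      rw [isUnit_iff_toZMod_ne_zero, not_not, map_sub, map_pow, h, sub_self]
    rw [isUnit_iff] at h1
    rw [not_isUnit_iff] at h2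
    simpa [h1, one_add_one_eq_two] using h2
  obtain ⟨z, hz, -⟩ := hensels_lemma hd
  exact ⟨z, by simpa [sub_eq_zero] using hz⟩

/-- A `2`-adic integer congruent to `1` modulo `8` is a square. -/
theorem exists_sq_of_toZModPow_three (a : ℤ_[2]) (h : toZModPow 3 a = 1) :
    ∃ z : ℤ_[2], z ^ 2 = a := by
  have h8 : a - 1 ∈ Ideal.span {((2 : ℕ) : ℤ_[2]) ^ 3} := by
    rw [← ker_toZModPow, RingHom.mem_ker, map_sub, h, map_one, sub_self]
  have hn := (norm_le_pow_iff_mem_span_pow _ 3).2 h8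
  have h2 : ‖(2 : ℤ_[2])‖ = 2⁻¹ := by simpa using norm_p (p := 2)
  -- Hensel at the approximate root `1`: `|1 - a| ≤ 1/8 < 1/4 = |2|²`.
  have hd : ‖(Polynomial.X ^ 2 - Polynomial.C a).aeval (1 : ℤ_[2])‖ <
      ‖(Polynomial.X ^ 2 - Polynomial.C a).derivative.aeval (1 : ℤ_[2])‖ ^ 2 := by
    rw [norm_sub_rev] at hn
    simp [one_add_one_eq_two, h2]
    refine hn.trans_lt ?_
    norm_num
  obtain ⟨z, hz, -⟩ := hensels_lemma hd
  exact ⟨z, by simpa [sub_eq_zero] using hz⟩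

/-- For odd `p`, every `p`-adic unit is a norm from an unramified quadratic extension. -/
theorem exists_eq_sq_sub_mul_sq (hp : p ≠ 2) {a b : ℤ_[p]} (ha : IsUnit a) (hb : IsUnit b) :
    ∃ u v : ℤ_[p], a = u ^ 2 - b * v ^ 2 := by
  have ha' := isUnit_iff_toZMod_ne_zero.1 ha
  have hb' := isUnit_iff_toZMod_ne_zero.1 hb
  -- Counting values of the two quadratics solves `x² - a - b y² = 0` modulo `p`. As `a` is a unit,
  -- `x` or `y` is nonzero, and that one is corrected by Hensel while the other is kept.
  obtain ⟨x, y, hxy⟩ := FiniteField.exists_root_sum_quadratic (R := ZMod p)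
    (f := Polynomial.X ^ 2 - Polynomial.C (toZMod a))
    (g := Polynomial.C (-toZMod b) * Polynomial.X ^ 2)
    (Polynomial.degree_X_pow_sub_C (by decide) _)
    (by rw [Polynomial.degree_C_mul (neg_ne_zero.2 hb'), Polynomial.degree_X_pow]; rfl)
    (by rw [ZMod.card]; exact (Nat.Prime.eq_two_or_odd Fact.out).resolve_left hp)
  simp at hxy
  obtain ⟨x', rfl⟩ := toZMod_surjective x
  obtain ⟨y', rfl⟩ := toZMod_surjective y
  by_cases hx : toZMod x' = 0
  · obtain ⟨b', hbb⟩ := hb.exists_right_inv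
    have h1 : toZMod b * toZMod b' = 1 := by rw [← map_mul, hbb, map_one]
    obtain ⟨z, hz⟩ := exists_sq_of_toZMod hp ((x' ^ 2 - a) * b') (toZMod y')
      (by
        intro hy
        rw [hx, hy] at hxy
        apply ha'
        simpa using hxy)
      (by
        simp only [map_mul, map_sub, map_pow]
        linear_combination toZMod b' * hxy + toZMod y' ^ 2 * h1)
    exact ⟨x', z, by linear_combination b * hz + (x' ^ 2 - a) * hbb⟩
  · obtain ⟨z, hz⟩ := exists_sq_of_toZMod hp (a + b * y' ^ 2) (toZMod x') hx
      (by
        simp only [map_mul, map_add, map_pow]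
        linear_combination -hxy)
    exact ⟨z, y', by rw [hz]; ring⟩

end PadicInt

/-! ### Products of values `1 - r²` in `ZMod p`. -/

/-- If `2` is not a square modulo a prime `p > 3`, every nonzero residue is a product of three
factors of the form `1 - r ^ 2`. -/
theorem ZMod.exists_one_sub_sq_mul {p : ℕ} [Fact p.Prime] (hp2 : p ≠ 2) (hp3 : p ≠ 3)
    (h2 : ¬ IsSquare (2 : ZMod p)) {c : ZMod p} (hc : c ≠ 0) :
    ∃ r s t : ZMod p, (1 - r ^ 2) * (1 - s ^ 2) * (1 - t ^ 2) = c := by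
  classical
  let A : Finset (ZMod p) := (Finset.univ.image fun r : ZMod p => 1 - r ^ 2).erase 0
  have hmem : ∀ u, u ∈ A ↔ u ≠ 0 ∧ ∃ r, 1 - r ^ 2 = u := by simp [A]
  -- A quadratic polynomial takes at least `p/2` values; dropping the value `0` and using that `p`
  -- is odd leaves at least `(p - 1)/2`.
  have hcard : p ≤ 2 * A.card + 1 := by
    have hdeg : (Polynomial.C (-1) * Polynomial.X ^ 2 + Polynomial.C (0 : ZMod p) * Polynomial.X
        + Polynomial.C 1).degree = 2 := Polynomial.degree_quadratic (neg_ne_zero.2 one_ne_zero)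
    have h := FiniteField.card_image_polynomial_eval (R := ZMod p)
      (p := Polynomial.C (-1) * Polynomial.X ^ 2 + Polynomial.C 0 * Polynomial.X + Polynomial.C 1)
      (by rw [hdeg]; decide)
    rw [Polynomial.natDegree_quadratic (neg_ne_zero.2 one_ne_zero), ZMod.card] at h
    have h0 : (0 : ZMod p) ∈ Finset.univ.image fun r : ZMod p => 1 - r ^ 2 :=
      Finset.mem_image.2 ⟨1, Finset.mem_univ _, by simp⟩
    have h1 := Finset.card_erase_add_one h0
    have h3 : (Finset.univ.image fun r : ZMod p => Polynomial.eval r (Polynomial.C (-1) *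
        Polynomial.X ^ 2 + Polynomial.C 0 * Polynomial.X + Polynomial.C 1)) =
        Finset.univ.image fun r : ZMod p => 1 - r ^ 2 := by
      congr 1
      ext r
      simp
      ring
    rw [h3] at h
    have hodd := (Nat.Prime.eq_two_or_odd (Fact.out : p.Prime)).resolve_left hp2
    change A.card + 1 = _ at h1
    omega
  by_contra! hne
  -- If `c` is not a triple product, `A·A` and `c A⁻¹` are disjoint sets of nonzero residues, so
  -- `A·A` has at most `(p - 1)/2` elements. Since `1 ∈ A`, also `A ⊆ A·A`, hence `A·A = A`.
  have hAA : ∀ u ∈ A, ∀ v ∈ A, u * v ∈ A := by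
    let B := (A ×ˢ A).image fun q => q.1 * q.2
    let C := A.image fun u => c * u⁻¹
    have hB : ∀ x ∈ B, ∃ u ∈ A, ∃ v ∈ A, u * v = x := by
      intro x hx
      obtain ⟨⟨u, v⟩, h, rfl⟩ := Finset.mem_image.1 hx
      exact ⟨u, (Finset.mem_product.1 h).1, v, (Finset.mem_product.1 h).2, rfl⟩
    have hBC : Disjoint B C := by
      rw [Finset.disjoint_left]
      intro x hx hx'
      obtain ⟨u, hu, v, hv, rfl⟩ := hB x hx
      obtain ⟨w, hw, h⟩ := Finset.mem_image.1 hx'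
      obtain ⟨-, r, rfl⟩ := (hmem u).1 hu
      obtain ⟨-, s, rfl⟩ := (hmem v).1 hv
      obtain ⟨hw0, t, rfl⟩ := (hmem w).1 hw
      apply hne r s t
      rw [← h, mul_assoc, inv_mul_cancel₀ hw0, mul_one]
    have hsub : A ⊆ B := fun u hu => Finset.mem_image.2
      ⟨(1, u), Finset.mem_product.2 ⟨(hmem 1).2 ⟨one_ne_zero, 0, by simp⟩, hu⟩, one_mul u⟩
    have hle : B.card + C.card ≤ p - 1 := by
      have hp : (Finset.univ.erase (0 : ZMod p)).card = p - 1 := by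
        rw [Finset.card_erase_of_mem (Finset.mem_univ _), Finset.card_univ, ZMod.card]
      rw [← Finset.card_union_of_disjoint hBC, ← hp]
      apply Finset.card_le_card
      intro x hx
      refine Finset.mem_erase.2 ⟨?_, Finset.mem_univ _⟩
      rcases Finset.mem_union.1 hx with hx | hx
      · obtain ⟨u, hu, v, hv, rfl⟩ := hB x hx
        exact mul_ne_zero ((hmem u).1 hu).1 ((hmem v).1 hv).1
      · obtain ⟨u, hu, rfl⟩ := Finset.mem_image.1 hx
        exact mul_ne_zero hc (inv_ne_zero ((hmem u).1 hu).1)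
    have hC : C.card = A.card := Finset.card_image_of_injective _ fun x y h =>
      inv_injective (mul_left_cancel₀ hc h)
    have hAB : A = B := Finset.eq_of_subset_of_card_le hsub (by omega)
    intro u hu v hv
    rw [hAB]
    exact Finset.mem_image.2 ⟨(u, v), Finset.mem_product.2 ⟨hu, hv⟩, rfl⟩
  have h20 : (2 : ZMod p) ≠ 0 := PadicInt.zmod_two_ne_zero hp2
  have h30 : (3 : ZMod p) ≠ 0 := by
    intro h
    have h' : ((3 : ℕ) : ZMod p) = 0 := by exact_mod_cast h
    rw [ZMod.natCast_eq_zero_iff] at h'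
    exact hp3 ((Nat.prime_dvd_prime_iff_eq Fact.out Nat.prime_three).1 h')
  obtain ⟨i, hi⟩ : ∃ i : ZMod p, 2 * i = 1 := ⟨2⁻¹, mul_inv_cancel₀ h20⟩
  obtain ⟨j, hj⟩ : ∃ j : ZMod p, 3 * j = 1 := ⟨3⁻¹, mul_inv_cancel₀ h30⟩
  have hsq : ∀ r : ZMod p, 1 - r ^ 2 ≠ 0 → ∃ s, 1 - s ^ 2 = (1 - r ^ 2) * (1 - r ^ 2) :=
    fun r hr => ((hmem _).1 (hAA _ ((hmem _).2 ⟨hr, r, rfl⟩) _ ((hmem _).2 ⟨hr, r, rfl⟩))).2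
  -- Closure under squaring at `r = 2, 3, 1/2` gives `a² = -8`, `b² = -63` and `d² = 7/16`. So `-2`,
  -- `-7` and `7` are squares, and therefore so is `2 = (-2)(-7)/7`. When `7 = 0`, instead `2 = 3²`.
  obtain ⟨a, ha⟩ := hsq 2 (by
    intro h
    exact h30 (by linear_combination -h))
  obtain ⟨b, hb⟩ := hsq 3 (by
    intro h
    exact pow_ne_zero 3 h20 (by linear_combination -h))
  obtain ⟨d, hd⟩ := hsq i (by
    intro h
    exact h30 (by linear_combination 4 * h + (2 * i + 1) * hi))
  by_cases h70 : (7 : ZMod p) = 0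
  · exact h2 ⟨3, by linear_combination -h70⟩
  · have hd7 : (4 * d) ^ 2 = 7 := by
      linear_combination -16 * hd + (8 * i ^ 3 + 4 * i ^ 2 - 14 * i - 7) * (-1) * hi
    have hb7 : (b * j) ^ 2 = -7 := by
      linear_combination -j ^ 2 * hb - 7 * (3 * j + 1) * hj
    have ha2 : (a * i) ^ 2 = -2 := by
      linear_combination -i ^ 2 * ha - 2 * (2 * i + 1) * hi
    refine h2 ⟨a * i * (b * j) / (4 * d), ?_⟩
    have hd0 : 4 * d ≠ 0 := by
      intro h
      rw [h] at hd7
      exact h70 (by simpa using hd7.symm)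
    rw [← sq, div_pow, mul_pow, ha2, hb7, hd7]
    field_simp

/-! ### The factored equation and the values of the classes at points. -/

namespace MarkoffK3
open BrauerAz MvPolynomial

theorem Pt.prod_eqn {k : ℤ} {S : Type} [CommRing S] (P : Pt k S) :
    (4 * P.x ^ 2 - 1) * (4 * P.y ^ 2 - 1) * (4 * P.z ^ 2 - 1) = 4 * k - 1 := by
  linear_combination 4 * P.eqn

/-- The `i`-th coordinate of a point. -/
def Pt.coords {k : ℤ} {S : Type} [CommRing S] (P : Pt k S) : Fin 3 → S := ![P.x, P.y, P.z]

/-- Exchange of the first two coordinates. -/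
def Pt.swap {k : ℤ} {S : Type} [CommRing S] (P : Pt k S) : Pt k S where
  x := P.y
  y := P.x
  z := P.z
  eqn := by linear_combination P.eqn

theorem Pt.four_mul_coords_sq_sub_one_dvd {k : ℤ} {S : Type} [CommRing S] (P : Pt k S)
    (i : Fin 3) : 4 * P.coords i ^ 2 - 1 ∣ 4 * (k : S) - 1 := by
  rw [← P.prod_eqn]
  fin_cases i
  · exact ⟨_, mul_assoc _ _ _⟩
  · exact ⟨(4 * P.x ^ 2 - 1) * (4 * P.z ^ 2 - 1), by simp [Pt.coords]; ring⟩
  · exact ⟨(4 * P.x ^ 2 - 1) * (4 * P.y ^ 2 - 1), by simp [Pt.coords]; ring⟩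

section evaluation
variable {k : ℤ} {K : Type} [Field K] [Algebra ℚ K]

theorem Pt.evalHom_coordUnit (P : Pt k K) (i : Fin 3) :
    P.evalHom (coordUnit k i : CoordRing k ℚ) = 4 * P.coords i ^ 2 - 1 := by
  change P.evalHom (4 * coord k i ^ 2 - 1) = _
  have : P.evalHom (coord k i) = P.coords i := by
    change aeval (R := ℚ) ![P.x, P.y, P.z] (X i) = _
    rw [aeval_X]
    rfl
  simp only [map_sub, map_mul, map_pow, map_ofNat, map_one, this]

theorem Pt.evalHom_constUnit (P : Pt k K) (hk : k ≠ 0) :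
    P.evalHom (constUnit k hk : CoordRing k ℚ) = k := by
  change P.evalHom (algebraMap ℚ (CoordRing k ℚ) (k : ℚ)) = _
  simp only [map_intCast]

theorem localInv_eq_zero_of_sq (hk : k ≠ 0) (P : Pt k K) (i : Fin 3) (c : K)
    (h : (k : K) = c ^ 2) : localInv K (Br2.map P.evalHom (𝒜 k hk i)) = 0 := by
  refine if_pos (Subtype.ext ?_)
  refine (map_quatClass _ _ _).trans (quatClass_eq_zero_of_sq _ _ c ?_)
  rw [← h]
  exact P.evalHom_constUnit hk

theorem localInv_eq_zero_of_norm (hk : k ≠ 0) (P : Pt k K) (i : Fin 3) (u v : K)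
    (h : 4 * P.coords i ^ 2 - 1 = u ^ 2 - k * v ^ 2) :
    localInv K (Br2.map P.evalHom (𝒜 k hk i)) = 0 := by
  refine if_pos (Subtype.ext ?_)
  refine (map_quatClass _ _ _).trans (quatClass_eq_zero _ _ u v ?_)
  rw [← P.evalHom_constUnit hk, ← P.evalHom_coordUnit] at h
  exact h

theorem localInv_eq_half (hk : k ≠ 0) (P : Pt k K) (i : Fin 3) (hs : ¬ IsSquare (k : K))
    (h : ∀ u v : K, 4 * P.coords i ^ 2 - 1 ≠ u ^ 2 - k * v ^ 2) :
    localInv K (Br2.map P.evalHom (𝒜 k hk i)) = ((1 / 2 : ℚ) : AddCircle (1 : ℚ)) := by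
  refine if_neg fun h0 => ?_
  have h1 : Br.map P.evalHom (𝒜 k hk i) = 0 := congrArg Subtype.val h0
  rw [← P.evalHom_constUnit hk] at hs h
  rw [← P.evalHom_coordUnit] at h
  exact quatClass_ne_zero (Units.map (P.evalHom : CoordRing k ℚ →* K) (coordUnit k i))
    (Units.map (P.evalHom : CoordRing k ℚ →* K) (constUnit k hk)) hs h ((map_quatClass _ _ _).symm.trans h1)

end evaluation

/-- Over the algebraic closure of `ℚ` the constant `k` becomes a square, so both generators split
there. -/
theorem subgroupA_le_brauer1Quot (k : ℤ) (hk : k ≠ 0) : subgroupA k hk ≤ brauer1Quot k := by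
  have h : ∀ i, (𝒜 k hk i : Br (CoordRing k ℚ)) ∈ brauer1 k := by
    intro i
    obtain ⟨c, hc⟩ := IsAlgClosed.exists_pow_nat_eq (k : AlgebraicClosure ℚ) two_pos
    refine (map_quatClass _ _ _).trans (quatClass_eq_zero_of_sq _ _
      (algebraMap (AlgebraicClosure ℚ) _ c) ?_)
    change toAlgClosure k (algebraMap ℚ (CoordRing k ℚ) (k : ℚ)) = _
    rw [← map_pow, hc]
    simp only [map_intCast]
  rw [subgroupA, AddSubgroup.closure_le]
  rintro _ (rfl | rfl)
  · exact AddSubgroup.mem_map_of_mem _ (h 0)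
  · exact AddSubgroup.mem_map_of_mem _ (h 1)

theorem half_ne_zero : ((1 / 2 : ℚ) : AddCircle (1 : ℚ)) ≠ 0 := by
  intro h
  rw [AddCircle.coe_eq_zero_iff] at h
  obtain ⟨n, hn⟩ := h
  have h2 : (2 * n : ℚ) = 1 := by
    simp at hn
    rw [hn]
    norm_num
  have h3 : 2 * n = 1 := by exact_mod_cast h2
  omega

/-- If `4 k - 1 = 0` in a field with `k = 18 ℓ ^ 2`, then `2` is a square. -/
theorem isSquare_two_of_four_mul_eq_one {F : Type} [Field F] {ℓ k : ℤ} (hk : k = 18 * ℓ ^ 2)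
    (h : (4 * k - 1 : F) = 0) : IsSquare (2 : F) := by
  subst hk
  push_cast at h
  have h1 : (2 : F) * (6 * ℓ) ^ 2 = 1 := by linear_combination h
  refine ⟨(6 * ℓ : F)⁻¹, ?_⟩
  rw [← mul_inv]
  exact eq_inv_of_mul_eq_one_left (by linear_combination h1)

/-! ### Local invariants at odd primes. -/

section odd
variable {p : ℕ} [Fact p.Prime] {ℓ k : ℤ}

theorem exists_sq_eq_k (hp : p ≠ 2) (hk : k = 18 * ℓ ^ 2) (h2 : IsSquare (2 : ZMod p)) :
    ∃ c : ℤ_[p], c ^ 2 = k := by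
  obtain ⟨s, hs⟩ := h2
  obtain ⟨z, hz⟩ := PadicInt.exists_sq_of_toZMod hp 2 s
    (by
      rintro rfl
      exact PadicInt.zmod_two_ne_zero hp (by simpa using hs))
    (by rw [map_ofNat, hs, sq])
  refine ⟨3 * ℓ * z, ?_⟩
  subst hk
  push_cast
  linear_combination 9 * (ℓ : ℤ_[p]) ^ 2 * hz

/-- If `2` is a square modulo `p`, so is `k` in `ℤ_p`. If not, `4k - 1` is a unit, hence so is its
divisor `4 P.coords i ^ 2 - 1`, and units are norms for the unit `2`. -/
theorem invPadic_eq_zero (hp : p ≠ 2) (hk0 : k ≠ 0) (hk : k = 18 * ℓ ^ 2) (P : Pt k ℤ_[p])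
    (i : Fin 3) : invPadic p (𝒜 k hk0 i) P = 0 := by
  by_cases h2 : IsSquare (2 : ZMod p)
  · obtain ⟨c, hc⟩ := exists_sq_eq_k hp hk h2
    refine localInv_eq_zero_of_sq hk0 _ i (c : ℚ_[p]) ?_
    have := congrArg (PadicInt.Coe.ringHom (p := p)) hc
    rw [map_intCast, map_pow] at this
    exact this.symm
  · have ha : IsUnit (4 * P.coords i ^ 2 - 1) := by
      rw [PadicInt.isUnit_iff_toZMod_ne_zero]
      intro h
      obtain ⟨t, ht⟩ := P.four_mul_coords_sq_sub_one_dvd i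
      have h3 := congrArg PadicInt.toZMod ht
      rw [map_mul, h, zero_mul, map_sub, map_mul, map_intCast, map_ofNat, map_one] at h3
      exact h2 (isSquare_two_of_four_mul_eq_one hk h3)
    have hb : IsUnit (2 : ℤ_[p]) := by
      rw [PadicInt.isUnit_iff_toZMod_ne_zero, map_ofNat]
      exact PadicInt.zmod_two_ne_zero hp
    obtain ⟨u, v, huv⟩ := PadicInt.exists_eq_sq_sub_mul_sq hp ha hb
    have h0 : (ℓ : ℚ_[p]) ≠ 0 := by
      rintro h
      apply hk0
      rw [hk, Int.cast_eq_zero.1 h]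
      rfl
    -- Since `k = 2(3ℓ)²`, dividing `v` by `3ℓ` turns a norm for `2` into one for `k`. This is done
    -- in `ℚ_p`, so `p` may divide `3ℓ`.
    refine localInv_eq_zero_of_norm hk0 _ i (PadicInt.Coe.ringHom u)
      (PadicInt.Coe.ringHom v / (3 * ℓ)) ?_
    have h4 := congrArg (PadicInt.Coe.ringHom (p := p)) huv
    have h5 : (P.map (PadicInt.Coe.ringHom (p := p))).coords i
        = PadicInt.Coe.ringHom (P.coords i) := by
      fin_cases i <;> rfl
    simp only [map_sub, map_mul, map_pow, map_ofNat, map_one] at h4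
    have h6 : (k : ℚ_[p]) = 18 * ℓ ^ 2 := by rw [hk]; push_cast; rfl
    rw [h5, h4, h6]
    field_simp
    ring

end odd

/-! ### Local invariants at `2`. -/

section two
variable {ℓ k : ℤ}

theorem even_or_odd_padicInt_two (x : ℤ_[2]) : (∃ y, x = 2 * y) ∨ ∃ y, x = 2 * y + 1 := by
  have h : ∀ x : ℤ_[2], PadicInt.toZMod x = 0 → ∃ y, x = 2 * y := by
    intro x hx
    rw [← RingHom.mem_ker, PadicInt.ker_toZMod, PadicInt.maximalIdeal_eq_span_p,
      Ideal.mem_span_singleton] at hx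
    simpa [dvd_def] using hx
  have h2 : ∀ t : ZMod 2, t = 0 ∨ t = 1 := by decide
  rcases h2 (PadicInt.toZMod x) with h0 | h1
  · exact Or.inl (h x h0)
  · obtain ⟨y, hy⟩ := h (x - 1) (by rw [map_sub, h1, map_one, sub_self])
    exact Or.inr ⟨y, by rw [← hy]; ring⟩

theorem exists_coe_of_sq (r : ℚ_[2]) (a : ℤ_[2]) (h : r ^ 2 = a) : ∃ s : ℤ_[2], (s : ℚ_[2]) = r := by
  refine ⟨⟨r, ?_⟩, rfl⟩
  have h1 : ‖r‖ ^ 2 ≤ 1 := by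
    rw [← norm_pow, h]
    exact a.2
  exact (sq_le_one_iff₀ (norm_nonneg r)).1 h1

theorem not_isSquare_two_padic : ¬ IsSquare (2 : ℚ_[2]) := by
  rintro ⟨r, hr⟩
  obtain ⟨s, rfl⟩ := exists_coe_of_sq r 2 (by rw [sq, ← hr]; rfl)
  have h : (2 : ℤ_[2]) = s * s := PadicInt.ext (by rw [PadicInt.coe_mul]; exact hr)
  have h1 := congrArg (PadicInt.toZModPow 3) h
  rw [map_mul, map_ofNat] at h1
  have key : ∀ s : ZMod (2 ^ 3), 2 ≠ s * s := by decide
  exact key _ h1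

/-- The Hilbert symbol `(a, 2)` is nontrivial for a `2`-adic integer `a` congruent to `3` modulo
`8`. -/
theorem ne_sq_sub_two_mul_sq (a : ℤ_[2]) (ha : PadicInt.toZModPow 3 a = 3) (u v : ℚ_[2]) :
    (a : ℚ_[2]) ≠ u ^ 2 - 2 * v ^ 2 := by
  intro h
  have h2 : ((2 : ℤ_[2]) : ℚ_[2]) = 2 := rfl
  by_cases hv : ‖v‖ ≤ 1
  · obtain ⟨v, rfl⟩ : ∃ w : ℤ_[2], (w : ℚ_[2]) = v := ⟨⟨v, hv⟩, rfl⟩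
    obtain ⟨u, rfl⟩ := exists_coe_of_sq u (a + 2 * v ^ 2) (by
      push_cast
      rw [h2]
      linear_combination -h)
    have h' : a = u ^ 2 - 2 * v ^ 2 :=
      PadicInt.ext (by push_cast; rw [h2]; exact h)
    have h1 := congrArg (PadicInt.toZModPow 3) h'
    rw [ha, map_sub, map_mul, map_pow, map_pow, map_ofNat] at h1
    have key : ∀ u v : ZMod (2 ^ 3), 3 ≠ u ^ 2 - 2 * v ^ 2 := by decide
    exact key _ _ h1
  -- For non-integral `v`, dividing by `v²` gives `(u/v)² = 2 + a w²` with `w = 1/v` divisible by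
  -- `2`; the right side is `2` modulo `4`, so not a square.
  · have hv0 : v ≠ 0 := by
      rintro rfl
      simp at hv
    have hw : ‖v⁻¹‖ < 1 := by
      rw [norm_inv]
      exact inv_lt_one_of_one_lt₀ (not_le.1 hv)
    obtain ⟨w, hw'⟩ : ∃ w : ℤ_[2], (w : ℚ_[2]) = v⁻¹ := ⟨⟨v⁻¹, hw.le⟩, rfl⟩
    rw [← hw'] at hw
    have hd := (PadicInt.norm_lt_one_iff_dvd w).1 hw
    obtain ⟨t, rfl⟩ := hd
    have h3 : (u * v⁻¹) ^ 2 = 2 + a * (v⁻¹) ^ 2 := by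
      field_simp
      linear_combination -h
    rw [← hw'] at h3
    obtain ⟨r, hr⟩ := exists_coe_of_sq _ (2 + a * ((2 : ℕ) * t) ^ 2)
      (by rw [h3]; push_cast; rfl)
    rw [← hr] at h3
    have h' : r ^ 2 = 2 + a * ((2 : ℕ) * t) ^ 2 :=
      PadicInt.ext (by rw [PadicInt.coe_pow, h3]; push_cast; rfl)
    have h1 := congrArg (PadicInt.toZModPow 3) h'
    rw [map_add, map_mul, map_pow, map_pow, map_mul, map_ofNat, ha, map_natCast] at h1
    have key : ∀ r t : ZMod (2 ^ 3), r ^ 2 ≠ 2 + 3 * (((2 : ℕ) : ZMod (2 ^ 3)) * t) ^ 2 := by decide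
    exact key _ _ h1

theorem sq_intCast_eq_one_of_odd (h2 : ¬ (2 : ℤ) ∣ ℓ) : (ℓ : ZMod (2 ^ 3)) ^ 2 = 1 := by
  obtain ⟨m, rfl⟩ := Int.not_even_iff_odd.1 (fun h => h2 h.two_dvd)
  push_cast
  have key : ∀ m : ZMod (2 ^ 3), (2 * m + 1) ^ 2 = 1 := by decide
  exact key _

/-- For an odd coordinate `t`, `4t² - 1 ≡ 3` modulo `8`, and up to squares `k` is `2`. -/
theorem invPadic_two_eq_half (hk0 : k ≠ 0) (hk : k = 18 * ℓ ^ 2) (P : Pt k ℤ_[2]) (i : Fin 3)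
    {t : ℤ_[2]} (ht : P.coords i = 2 * t + 1) :
    invPadic 2 (𝒜 k hk0 i) P = ((1 / 2 : ℚ) : AddCircle (1 : ℚ)) := by
  have h0 : (ℓ : ℚ_[2]) ≠ 0 := by
    rintro h
    apply hk0
    rw [hk, Int.cast_eq_zero.1 h]
    rfl
  refine localInv_eq_half hk0 _ i ?_ ?_
  · rintro ⟨r, hr⟩
    refine not_isSquare_two_padic ⟨r / (3 * ℓ), ?_⟩
    rw [hk] at hr
    push_cast at hr
    field_simp
    linear_combination hr
  · intro u v huv
    have h5 : (P.map (PadicInt.Coe.ringHom (p := 2))).coords i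
        = PadicInt.Coe.ringHom (P.coords i) := by
      fin_cases i <;> rfl
    refine ne_sq_sub_two_mul_sq (4 * P.coords i ^ 2 - 1) ?_ u (3 * ℓ * v) ?_
    · rw [ht]
      simp only [map_sub, map_mul, map_pow, map_add, map_ofNat, map_one]
      have key : ∀ m : ZMod (2 ^ 3), 4 * (2 * m + 1) ^ 2 - 1 = 3 := by decide
      exact key _
    · have h6 : (k : ℚ_[2]) = 18 * ℓ ^ 2 := by rw [hk]; push_cast; rfl
      have h7 : ((4 * P.coords i ^ 2 - 1 : ℤ_[2]) : ℚ_[2])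
          = 4 * PadicInt.Coe.ringHom (P.coords i) ^ 2 - 1 := by
        change PadicInt.Coe.ringHom (4 * P.coords i ^ 2 - 1) = _
        simp only [map_sub, map_mul, map_pow, map_ofNat, map_one]
      rw [h5, h6] at huv
      rw [h7, huv]
      ring

theorem invPadic_two (h2 : ¬ (2 : ℤ) ∣ ℓ) (hk0 : k ≠ 0) (hk : k = 18 * ℓ ^ 2) (P : Pt k ℤ_[2]) :
    invPadic 2 (𝒜 k hk0 0) P = ((1 / 2 : ℚ) : AddCircle (1 : ℚ)) ∨
      invPadic 2 (𝒜 k hk0 1) P = ((1 / 2 : ℚ) : AddCircle (1 : ℚ)) := by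
  rcases even_or_odd_padicInt_two P.x with ⟨a, ha⟩ | ⟨a, ha⟩
  · rcases even_or_odd_padicInt_two P.y with ⟨b, hb⟩ | ⟨b, hb⟩
    · exfalso
      have h := congrArg (PadicInt.toZModPow 3) P.eqn
      have hk' : (k : ℤ_[2]) = 18 * ℓ ^ 2 := by rw [hk]; push_cast; rfl
      rw [ha, hb, hk'] at h
      simp only [map_sub, map_mul, map_pow, map_add, map_ofNat, map_intCast,
        sq_intCast_eq_one_of_odd h2] at h
      generalize PadicInt.toZModPow 3 a = a' at h
      generalize PadicInt.toZModPow 3 b = b' at h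
      generalize PadicInt.toZModPow 3 P.z = c' at h
      -- With `x` and `y` even and `ℓ` odd, the equation forces `z² ≡ k ≡ 2` modulo `4`.
      have h' : c' ^ 2 = 2 + 4 * (4 - a' ^ 2 - b' ^ 2 + (16 * a' ^ 2 * b' ^ 2
          + 4 * b' ^ 2 * c' ^ 2 + 4 * c' ^ 2 * a' ^ 2) - 64 * (a' ^ 2 * b' ^ 2 * c' ^ 2)) := by
        linear_combination h
      have key : ∀ c d : ZMod (2 ^ 3), c ^ 2 ≠ 2 + 4 * d := by decide
      exact key _ _ h'
    · exact Or.inr (invPadic_two_eq_half hk0 hk P 1 hb)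
  · exact Or.inl (invPadic_two_eq_half hk0 hk P 0 ha)

end two
end MarkoffK3

namespace MarkoffK3
open BrauerAz MvPolynomial

/-! ### Local solubility. -/

section solubility
variable {p : ℕ} [Fact p.Prime] {ℓ k : ℤ}

/-- The rotation of the coordinates. -/
def Pt.rotate {S : Type} [CommRing S] (P : Pt k S) : Pt k S where
  x := P.y
  y := P.z
  z := P.x
  eqn := by linear_combination P.eqn

theorem nonempty_pt_of_sq {S : Type} [CommRing S] (c : S) (h : c ^ 2 = k) : Nonempty (Pt k S) :=
  ⟨⟨c, 0, 0, by linear_combination h⟩⟩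

/-- Lifting of points modulo an odd prime. -/
theorem nonempty_pt_padic_of_mod (hp : p ≠ 2) (P : Pt k (ZMod p)) (hx : P.x ≠ 0)
    (hk : (4 * k - 1 : ZMod p) ≠ 0) : Nonempty (Pt k ℤ_[p]) := by
  obtain ⟨Y, hY⟩ := PadicInt.toZMod_surjective P.y
  obtain ⟨Z, hZ⟩ := PadicInt.toZMod_surjective P.z
  have hprod := P.prod_eqn
  rw [← hY, ← hZ] at hprod
  -- The equation is linear in `x²` with coefficient `(4y² - 1)(4z² - 1)`, a divisor of the unit `4k
  -- - 1`. So `y` and `z` can be lifted arbitrarily and only a square root for `x` has to be found.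
  have hD : IsUnit ((4 * Y ^ 2 - 1) * (4 * Z ^ 2 - 1)) := by
    rw [PadicInt.isUnit_iff_toZMod_ne_zero]
    intro h
    simp only [map_sub, map_mul, map_pow, map_ofNat, map_one] at h
    apply hk
    rw [← hprod, mul_assoc, h, mul_zero]
  obtain ⟨E, hE⟩ := hD.exists_right_inv
  have hE' := congrArg PadicInt.toZMod hE
  have heqn := P.eqn
  rw [← hY, ← hZ] at heqn
  simp only [map_sub, map_mul, map_pow, map_ofNat, map_one] at hE'
  obtain ⟨X, hX⟩ := PadicInt.exists_sq_of_toZMod hp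
    ((k - Y ^ 2 - Z ^ 2 + 4 * Y ^ 2 * Z ^ 2) * E) P.x hx (by
      simp only [map_sub, map_add, map_mul, map_pow, map_ofNat, map_intCast]
      linear_combination -PadicInt.toZMod E * heqn + P.x ^ 2 * hE')
  exact ⟨⟨X, Y, Z, by
    linear_combination (4 * Y ^ 2 - 1) * (4 * Z ^ 2 - 1) * hX
      + (k - Y ^ 2 - Z ^ 2 + 4 * Y ^ 2 * Z ^ 2) * hE⟩⟩

/-- Writing the coordinates as `r/2`, `s/2`, `t/2` turns the equation into `(1 - r²)(1 - s²)(1 - t²)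
= 1 - 4k`. Since `p` does not divide `k`, some coordinate is nonzero modulo `p`; a rotation makes it
the one to be lifted. -/
theorem nonempty_pt_padic_of_not_isSquare (hp2 : p ≠ 2) (hp3 : p ≠ 3)
    (h2 : ¬ IsSquare (2 : ZMod p)) (hk : k = 18 * ℓ ^ 2) (hpk : (k : ZMod p) ≠ 0) :
    Nonempty (Pt k ℤ_[p]) := by
  have hk1 : (4 * k - 1 : ZMod p) ≠ 0 := fun h => h2 (isSquare_two_of_four_mul_eq_one hk h)
  have h20 := PadicInt.zmod_two_ne_zero hp2
  obtain ⟨r, s, t, h⟩ := ZMod.exists_one_sub_sq_mul hp2 hp3 h2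
    (c := 1 - 4 * (k : ZMod p)) (fun h => hk1 (by linear_combination -h))
  let P : Pt k (ZMod p) :=
    { x := r / 2
      y := s / 2
      z := t / 2
      eqn := by
        have h4 : (4 : ZMod p) ≠ 0 := by
          intro h4
          exact pow_ne_zero 2 h20 (by linear_combination h4)
        apply mul_left_cancel₀ h4
        field_simp
        linear_combination -16 * h }
  by_cases hx : P.x = 0
  · by_cases hy : P.y = 0
    · by_cases hz : P.z = 0
      · have := P.eqn
        rw [hx, hy, hz] at this
        exact absurd (by linear_combination -this) hpk
      · exact nonempty_pt_padic_of_mod hp2 P.rotate.rotate hz hk1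
    · exact nonempty_pt_padic_of_mod hp2 P.rotate hy hk1
  · exact nonempty_pt_padic_of_mod hp2 P hx hk1

/-- The point `(3x, 3, 0)` requires `35x² = 1 - 2ℓ²`, and `(1 - 2ℓ²)/35 ≡ 1` modulo `3`. -/
theorem nonempty_pt_padic_three (h3 : ¬ (3 : ℤ) ∣ ℓ) (hk : k = 18 * ℓ ^ 2) :
    Nonempty (Pt k ℤ_[3]) := by
  have hk' : (k : ℤ_[3]) = 18 * ℓ ^ 2 := by rw [hk]; push_cast; rfl
  have hl : (ℓ : ZMod 3) ^ 2 = 1 := by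
    have h0 : (ℓ : ZMod 3) ≠ 0 := by rwa [Ne, ZMod.intCast_zmod_eq_zero_iff_dvd]
    generalize (ℓ : ZMod 3) = m at h0
    revert m
    decide
  have hu : IsUnit (35 : ℤ_[3]) := by
    rw [PadicInt.isUnit_iff_toZMod_ne_zero, map_ofNat]
    decide
  obtain ⟨e, he⟩ := hu.exists_right_inv
  have he' := congrArg PadicInt.toZMod he
  rw [map_mul, map_ofNat, map_one] at he'
  obtain ⟨x, hx⟩ := PadicInt.exists_sq_of_toZMod (p := 3) (by decide)
    ((1 - 2 * (ℓ : ℤ_[3]) ^ 2) * e) 1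
    one_ne_zero (by
      simp only [map_sub, map_mul, map_pow, map_ofNat, map_intCast, map_one, hl]
      generalize PadicInt.toZMod e = e' at he'
      revert e'
      decide)
  exact ⟨⟨3 * x, 3, 0, by
    rw [hk']
    linear_combination -315 * hx - 9 * (1 - 2 * (ℓ : ℤ_[3]) ^ 2) * he⟩⟩

/-- The point `(x, 1, 2)` requires `45x² = k + 11`, where both `45` and `k + 11` are `5` modulo `8`.
-/
theorem nonempty_pt_padic_two (h2 : ¬ (2 : ℤ) ∣ ℓ) (hk : k = 18 * ℓ ^ 2) :
    Nonempty (Pt k ℤ_[2]) := by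
  have hk' : (k : ℤ_[2]) = 18 * ℓ ^ 2 := by rw [hk]; push_cast; rfl
  have hu : IsUnit (45 : ℤ_[2]) := by
    rw [PadicInt.isUnit_iff_toZMod_ne_zero, map_ofNat]
    decide
  obtain ⟨e, he⟩ := hu.exists_right_inv
  have he' := congrArg (PadicInt.toZModPow 3) he
  rw [map_mul, map_ofNat, map_one] at he'
  obtain ⟨x, hx⟩ := PadicInt.exists_sq_of_toZModPow_three ((18 * (ℓ : ℤ_[2]) ^ 2 + 11) * e) (by
    simp only [map_add, map_mul, map_pow, map_ofNat, map_intCast, sq_intCast_eq_one_of_odd h2]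
    generalize PadicInt.toZModPow 3 e = e' at he'
    revert e'
    decide)
  exact ⟨⟨x, 1, 2, by
    rw [hk']
    linear_combination 45 * hx + (18 * (ℓ : ℤ_[2]) ^ 2 + 11) * he⟩⟩

theorem nonempty_pt_padic (h2 : ¬ (2 : ℤ) ∣ ℓ) (h3 : ¬ (3 : ℤ) ∣ ℓ)
    (hl : ∀ p : ℕ, p.Prime → (p : ℤ) ∣ ℓ → (p : ℤ) ≡ 1 [ZMOD 8] ∨ (p : ℤ) ≡ -1 [ZMOD 8])
    (hk : k = 18 * ℓ ^ 2) (p : ℕ) [Fact p.Prime] : Nonempty (Pt k ℤ_[p]) := by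
  by_cases hp2 : p = 2
  · subst hp2
    exact nonempty_pt_padic_two h2 hk
  by_cases hp3 : p = 3
  · subst hp3
    exact nonempty_pt_padic_three h3 hk
  by_cases hs : IsSquare (2 : ZMod p)
  · obtain ⟨c, hc⟩ := exists_sq_eq_k hp2 hk hs
    exact nonempty_pt_of_sq c hc
  -- Here `p ∤ k`: a prime `p > 3` dividing `k` divides `ℓ`, so is `±1` modulo `8`, which makes `2`
  -- a square.
  refine nonempty_pt_padic_of_not_isSquare hp2 hp3 hs hk fun h0 => ?_
  rw [ZMod.intCast_zmod_eq_zero_iff_dvd, hk] at h0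
  have hpp : p.Prime := Fact.out
  have hpi := Nat.prime_iff_prime_int.1 hpp
  rcases hpi.dvd_or_dvd h0 with h | h
  · have h' : p ∣ 2 * 3 ^ 2 := by exact_mod_cast h
    rcases hpp.dvd_mul.1 h' with h' | h'
    · exact hp2 ((Nat.prime_dvd_prime_iff_eq hpp Nat.prime_two).1 h')
    · exact hp3 ((Nat.prime_dvd_prime_iff_eq hpp Nat.prime_three).1 (hpp.dvd_of_dvd_pow h'))
  · apply hs
    rw [ZMod.exists_sq_eq_two_iff hp2]
    have := hl p hpp (hpi.dvd_of_dvd_pow h)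
    simp only [Int.ModEq] at this
    omega

theorem nonempty_adelicPt (h2 : ¬ (2 : ℤ) ∣ ℓ) (h3 : ¬ (3 : ℤ) ∣ ℓ)
    (hl : ∀ p : ℕ, p.Prime → (p : ℤ) ∣ ℓ → (p : ℤ) ≡ 1 [ZMOD 8] ∨ (p : ℤ) ≡ -1 [ZMOD 8])
    (hk : k = 18 * ℓ ^ 2) : Nonempty (AdelicPt k) := by
  have hreal : (Real.sqrt k) ^ 2 = (k : ℝ) := by
    refine Real.sq_sqrt ?_
    rw [hk]
    positivity
  exact ⟨⟨fun p _ => (nonempty_pt_padic h2 h3 hl hk p).some, (nonempty_pt_of_sq _ hreal).some⟩⟩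

end solubility

/-! ### Absence of integral points. -/

section integral
variable {ℓ k : ℤ}

/-- A natural number all of whose prime factors are `±1` modulo `8` is `±1` modulo `8`. -/
theorem mod_eight_of_primes (n : ℕ) (hn : n ≠ 0)
    (h : ∀ p : ℕ, p.Prime → p ∣ n → p % 8 = 1 ∨ p % 8 = 7) : n % 8 = 1 ∨ n % 8 = 7 := by
  induction n using Nat.recOnMul with
  | zero => exact absurd rfl hn
  | one => exact Or.inl rfl
  | prime p hp => exact h p hp dvd_rfl
  | mul a b iha ihb =>
    have ha := iha (left_ne_zero_of_mul hn) fun p hp hd => h p hp (hd.mul_right b)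
    have hb := ihb (right_ne_zero_of_mul hn) fun p hp hd => h p hp (hd.mul_left a)
    rw [Nat.mul_mod]
    rcases ha with ha | ha <;> rcases hb with hb | hb <;> simp [ha, hb]

/-- Every prime factor of `4x² - 1` divides `4k - 1`, so has `2` as a square residue and is `±1`
modulo `8`. Hence so is the positive integer `4x² - 1`, whereas an odd `x` makes it `3` modulo `8`.
-/
theorem Pt.even_x (hk : k = 18 * ℓ ^ 2) (P : Pt k ℤ) : Even P.x := by
  by_contra hx
  obtain ⟨m, hm⟩ := Int.not_even_iff_odd.1 hx
  have hmod : (4 * P.x ^ 2 - 1) % 8 = 3 := by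
    have : 4 * P.x ^ 2 - 1 = 8 * (2 * m ^ 2 + 2 * m) + 3 := by rw [hm]; ring
    omega
  have hpos : 0 ≤ 4 * P.x ^ 2 - 1 := by
    have : P.x ≠ 0 := by rintro h; rw [h] at hx; exact hx Even.zero
    have := Int.one_le_abs this
    nlinarith [sq_abs P.x]
  obtain ⟨n, hn⟩ := Int.eq_ofNat_of_zero_le hpos
  have := mod_eight_of_primes n (by omega) (by
    intro p hp hd
    have : Fact p.Prime := ⟨hp⟩
    have hp2 : p ≠ 2 := by rintro rfl; omega
    rw [← ZMod.exists_sq_eq_two_iff hp2]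
    apply isSquare_two_of_four_mul_eq_one hk
    have h0 : (((4 * P.x ^ 2 - 1 : ℤ)) : ZMod p) = 0 := by
      rw [hn, ZMod.intCast_zmod_eq_zero_iff_dvd]
      exact_mod_cast hd
    have h1 := congrArg (Int.castRingHom (ZMod p)) P.prod_eqn
    simp only [map_mul, eq_intCast, h0, zero_mul] at h1
    rw [h1]
    push_cast
    rfl)
  omega

/-- By symmetry `y` is even as well, and then `z² ≡ k ≡ 2` modulo `4`. -/
theorem isEmpty_pt_int (h2 : ¬ (2 : ℤ) ∣ ℓ) (hk : k = 18 * ℓ ^ 2) : IsEmpty (Pt k ℤ) := by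
  refine ⟨fun P => ?_⟩
  obtain ⟨a, ha⟩ := (P.even_x hk).two_dvd
  obtain ⟨b, hb⟩ := (P.swap.even_x hk).two_dvd
  obtain ⟨m, hm⟩ := Int.not_even_iff_odd.1 (fun h => h2 h.two_dvd)
  change P.y = 2 * b at hb
  have h := P.eqn
  rw [ha, hb] at h
  have h' : P.z ^ 2 = 2 + 4 * (4 + 18 * m ^ 2 + 18 * m - a ^ 2 - b ^ 2 + (16 * a ^ 2 * b ^ 2
      + 4 * b ^ 2 * P.z ^ 2 + 4 * P.z ^ 2 * a ^ 2) - 64 * (a ^ 2 * b ^ 2 * P.z ^ 2)) := by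
    simp only [Int.cast_id] at h
    rw [hm] at hk
    linear_combination h + hk
  have h4 := congrArg (Int.castRingHom (ZMod 4)) h'
  simp only [eq_intCast] at h4
  push_cast at h4
  have hz4 : (4 : ZMod 4) = 0 := rfl
  rw [hz4, zero_mul] at h4
  have key : ∀ c : ZMod 4, c ^ 2 ≠ 2 + 0 := by decide
  exact key _ h4

end integral

/-! ### The Brauer–Manin obstruction. -/

section BrauerManin
variable {ℓ k : ℤ}

theorem invReal_eq_zero (hk0 : k ≠ 0) (hk : 0 ≤ k) (P : Pt k ℝ) (i : Fin 3) :
    invReal (𝒜 k hk0 i) P = 0 :=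
  localInv_eq_zero_of_sq hk0 P i (Real.sqrt k)
    (Real.sq_sqrt (by exact_mod_cast hk)).symm

theorem pairing_𝒜 (hk0 : k ≠ 0) (hk : k = 18 * ℓ ^ 2) (P : AdelicPt k) (i : Fin 3) :
    pairing P (𝒜 k hk0 i) = invPadic 2 (𝒜 k hk0 i) (P.padic 2) := by
  rw [pairing, invReal_eq_zero hk0 (by rw [hk]; positivity), add_zero]
  refine finsum_eq_single _ (⟨2, Nat.prime_two⟩ : Nat.Primes) fun p hp => ?_
  have : Fact (p : ℕ).Prime := ⟨p.2⟩
  exact invPadic_eq_zero (fun h => hp (Subtype.ext h)) hk0 hk _ i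

theorem brauerManinSet_eq_empty (h2 : ¬ (2 : ℤ) ∣ ℓ) (hk0 : k ≠ 0) (hk : k = 18 * ℓ ^ 2) :
    brauerManinSet k (subgroupA k hk0) = ∅ := by
  refine Set.eq_empty_iff_forall_notMem.2 fun P hP => ?_
  have h0 := hP (𝒜 k hk0 0) (AddSubgroup.subset_closure (Or.inl rfl))
  have h1 := hP (𝒜 k hk0 1) (AddSubgroup.subset_closure (Or.inr rfl))
  rw [pairing_𝒜 hk0 hk] at h0 h1
  rcases invPadic_two h2 hk0 hk (P.padic 2) with h | h
  · exact half_ne_zero (h.symm.trans h0)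
  · exact half_ne_zero (h.symm.trans h1)

end BrauerManin

end MarkoffK3

theorem mainTheorem3 (ℓ : ℤ) (h2 : ¬ (2 : ℤ) ∣ ℓ) (h3 : ¬ (3 : ℤ) ∣ ℓ)
    (h5 : ℓ ≡ 1 [ZMOD 5]) (h7 : ℓ ≡ 2 [ZMOD 7])
    (hp : ∀ p : ℕ, p.Prime → (p : ℤ) ∣ ℓ → (p : ℤ) ≡ 1 [ZMOD 8] ∨ (p : ℤ) ≡ -1 [ZMOD 8])
    (k : ℤ) (hk : k = 18 * ℓ ^ 2) :
    ∃ hk0 : k ≠ 0,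
      -- the subgroup `A` lies in `Br₁ / Br₀`
      MarkoffK3.subgroupA k hk0 ≤ MarkoffK3.brauer1Quot k ∧
      -- there is a Brauer--Manin obstruction to the integral Hasse principle with respect to `A`
      Nonempty (MarkoffK3.AdelicPt k) ∧
      Set.range (MarkoffK3.diag (k := k)) ⊆
        MarkoffK3.brauerManinSet k (MarkoffK3.subgroupA k hk0) ∧
      MarkoffK3.brauerManinSet k (MarkoffK3.subgroupA k hk0) = ∅ ∧
      IsEmpty (MarkoffK3.Pt k ℤ) ∧
      -- the local invariants of the two generators
      (∀ P : MarkoffK3.Pt k ℝ, ∀ i : Fin 3, i = 0 ∨ i = 1 →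
        MarkoffK3.invReal (MarkoffK3.𝒜 k hk0 i) P = 0) ∧
      (∀ (p : ℕ) [Fact p.Prime], p ≠ 2 → ∀ P : MarkoffK3.Pt k ℤ_[p], ∀ i : Fin 3, i = 0 ∨ i = 1 →
        MarkoffK3.invPadic p (MarkoffK3.𝒜 k hk0 i) P = 0) ∧
      (∀ P : MarkoffK3.Pt k ℤ_[2],
        MarkoffK3.invPadic 2 (MarkoffK3.𝒜 k hk0 0) P = ((1 / 2 : ℚ) : AddCircle (1 : ℚ)) ∨
        MarkoffK3.invPadic 2 (MarkoffK3.𝒜 k hk0 1) P = ((1 / 2 : ℚ) : AddCircle (1 : ℚ))) := by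

  have hk0 : k ≠ 0 := by
    rintro rfl
    have : ℓ = 0 := by simpa using hk.symm
    exact h2 (this ▸ dvd_zero 2)
  have hempty := MarkoffK3.isEmpty_pt_int h2 hk
  refine ⟨hk0, MarkoffK3.subgroupA_le_brauer1Quot k hk0,
    MarkoffK3.nonempty_adelicPt h2 h3 hp hk, ?_,
    MarkoffK3.brauerManinSet_eq_empty h2 hk0 hk, hempty,
    fun P i _ => MarkoffK3.invReal_eq_zero hk0 (by rw [hk]; positivity) P i,
    fun p _ hp2 P i _ => MarkoffK3.invPadic_eq_zero hp2 hk0 hk P i,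
    fun P => MarkoffK3.invPadic_two h2 hk0 hk P⟩
  -- The inclusion holds because there are no integral points.
  rw [Set.range_eq_empty]
  exact Set.empty_subset _
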